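/- Let $A$ denote an arbitrary C*-algebra and $V$ a finitely generated projective Hilbert $A$-module (a Hilbert $A$-module isomorphic to $pA^k$ for a projection $p\in\mathcal L_A(A^k)$, where $\mathcal L_A$ denotes adjointable operators with the operator norm). A Hilbert $A$-module bundle is a fibre bundle with typical fibre such a $V$ and structure group the unitary group $U(\mathcal L_A(V))$. Let $X$ be an (abstract) simplicial complex with geometric realization $|X|$; every closed simplex $|\sigma|\subset|X|$ carries the Euclidean metric of the standard simplex. An *$\varepsilon$-flat bundle* over $X$ ($\varepsilon>0$) is a Hilbert $A$-module bundle $E\to|X|$ together with trivializations $\Phi_\sigma\colon|\sigma|\times V\to E|_{|\sigma|}$ (isomorphisms of Hilbert $A$-modules on each fibre), one for each simplex $\sigma$ of $X$, such that for all simplices $\rho\subset\sigma$ the transition function $$\Psi_{\rho\subset\sigma}\colon|\rho|\to U(\mathcal L_A(V)),\qquad x\mapsto\Phi_\rho(x,\cdot)^{-1}\circ\Phi_\sigma(x,\cdot)$$ is $\varepsilon$-Lipschitz. A *global $\varepsilon'$-trivialization* of it is a trivialization $\Phi_X\colon|X|\times V\to E$ such that for every simplex $\rho$ of $X$ the map $|\rho|\to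 U(\mathcal L_A(V))$, $x\mapsto\Phi_\rho(x,\cdot)^{-1}\circ\Phi_X(x,\cdot)$, is $\varepsilon'$-Lipschitz. A simplicial path in $X$ is a tuple of vertices $\Gamma=(v_0,\dots,v_k)$ such that each $\{v_i,v_{i+1}\}$ is a 1-simplex; transport along an edge $\sigma=\{v,w\}$ is $T_{(v,w)}=\Phi_\sigma(w,\cdot)\Phi_\sigma(v,\cdot)^{-1}\colon E_v\to E_w$, and $T_\Gamma=T_{(v_{k-1},v_k)}\cdots T_{(v_0,v_1)}$. A simplicial loop is *contractible* if it is null-homotopic in $|X|$ relative to its base point. Its *homotopical complexity* $\mathrm{hc}(\Gamma)$ is the minimal number of insertions or omissions of pieces $(a,b,c,a)$ with $\{a,b,c\}$ a 2-simplex in a finite sequence of moves that produces $\Gamma$ from the empty loop at its base point, where insertions and omissions of pieces $(a,b,a)$ with $\{a,b\}$ a 1-simplex are also allowed and are not counted. **(1) Transport.** There are constants $c(n),\delta(n)>0$ ($n\in\mathbb N$), depending only on $n$, such that for every simplicial complex $X$ and every contractible simplicial loop $\Gamma$ in $X$ the homotopical complexity $n=\mathrm{hc}(\Gamma)$ is finite,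 and for every $A$, every $\varepsilon>0$ with $\varepsilon\le\delta(n)$ and every $\varepsilon$-flat bundle of Hilbert $A$-modules over $X$, $$\|T_\Gamma-\mathrm{id}\|\le c(n)\,\varepsilon .$$ **(2) Trivialization.** For every finite simplicial complex $X$ whose realization $|X|$ is contractible there are constants $C(X),\delta(X)>0$, depending only on $X$, such that for every $A$ and every $\varepsilon>0$ with $\varepsilon\le\delta(X)$, every $\varepsilon$-flat bundle of Hilbert $A$-modules over $X$ admits a global $C(X)\varepsilon$-trivialization. -/

import Mathlib

open Bundle Topology
open scoped InnerProductSpace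

noncomputable section

/-! ### Geometric realization of an abstract simplicial complex -/

namespace AbstractSimplicialComplex

/-- The geometric realization `|X|`: its points are the formal convex combinations of vertices
whose support is a simplex of `X`. -/
@[ext]
structure Realization {ι : Type*} (X : AbstractSimplicialComplex ι) where
  /-- the barycentric coordinates of the point -/
  coord : ι →₀ ℝ
  support_mem : coord.support ∈ X.faces
  nonneg : ∀ v, 0 ≤ coord v
  sum_eq_one : (coord.sum fun _ a => a) = 1

open Classical in
/-- The map `j_σ : Δ^σ → |X|`, extending barycentric coordinates by zero. Here `Δ^σ` is the
standard simplex with vertex set `σ`. -/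
def simplexMap {ι : Type*} (X : AbstractSimplicialComplex ι) (σ : X.faces)
    (f : stdSimplex ℝ (σ : Finset ι)) : X.Realization := by
  let g : ι →₀ ℝ := Finsupp.onFinset (σ : Finset ι)
    (fun v => if h : v ∈ (σ : Finset ι) then f.1 ⟨v, h⟩ else 0)
    (fun v hv => by by_contra h; exact hv (by simp [h]))
  have hsum : (g.sum fun _ a => a) = 1 := by
    rw [Finsupp.onFinset_sum _ (fun _ => rfl), ← Finset.sum_coe_sort]
    simpa using f.2.2
  refine ⟨g, (X.isRelLowerSet_faces σ.2).2 Finsupp.support_onFinset_subset ?_, fun v => ?_, hsum⟩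
  · rw [Finsupp.support_nonempty_iff]
    intro h
    rw [h] at hsum
    simp at hsum
  · simp only [g, Finsupp.onFinset_apply]
    split_ifs with h
    · exact f.2.1 _
    · exact le_rfl

/-- The topology of `|X|`: a set is open iff its preimage under every `j_σ` is open. -/
instance {ι : Type*} (X : AbstractSimplicialComplex ι) : TopologicalSpace X.Realization :=
  ⨆ σ : X.faces, TopologicalSpace.coinduced (X.simplexMap σ) inferInstance

theorem isOpen_realization_iff {ι : Type*} (X : AbstractSimplicialComplex ι)
    (U : Set X.Realization) : IsOpen U ↔ ∀ σ : X.faces, IsOpen (X.simplexMap σ ⁻¹' U) := by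
  rw [isOpen_iSup_iff]
  exact Iff.rfl

theorem continuous_simplexMap {ι : Type*} (X : AbstractSimplicialComplex ι) (σ : X.faces) :
    Continuous (X.simplexMap σ) :=
  continuous_def.2 fun _ hU => (X.isOpen_realization_iff _).1 hU σ

/-- The closed simplex `|σ| ⊆ |X|`. -/
def closedSimplex {ι : Type*} (X : AbstractSimplicialComplex ι) (σ : Finset ι) :
    Set X.Realization :=
  {x | x.coord.support ⊆ σ}

theorem closedSimplex_mono {ι : Type*} (X : AbstractSimplicialComplex ι) {ρ σ : Finset ι}
    (h : ρ ⊆ σ) : X.closedSimplex ρ ⊆ X.closedSimplex σ :=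
  fun _ hx => Finset.Subset.trans hx h

/-- The image of `j_σ` is the closed simplex `|σ|`. -/
theorem range_simplexMap {ι : Type*} (X : AbstractSimplicialComplex ι) (σ : X.faces) :
    Set.range (X.simplexMap σ) = X.closedSimplex σ.1 := by
  classical
  ext x
  constructor
  · rintro ⟨f, rfl⟩
    intro v hv
    by_contra h
    exact (Finsupp.mem_support_iff.1 hv) (by simp [simplexMap, h])
  · intro hx
    refine ⟨⟨fun v => x.coord v, fun v => x.nonneg v, ?_⟩, ?_⟩
    · refine Eq.trans ?_ x.sum_eq_one
      rw [Finsupp.sum_of_support_subset _ hx _ (fun _ _ => rfl)]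
      exact Finset.sum_coe_sort σ.1 (fun v => x.coord v)
    · refine Realization.ext (Finsupp.ext fun v => ?_)
      by_cases h : v ∈ σ.1
      · simp [simplexMap, h]
      · have : v ∉ x.coord.support := fun hv => h (hx hv)
        simp [simplexMap, h, Finsupp.notMem_support_iff.1 this]

/-- The Euclidean distance of two points of the closed simplex `|σ|`, in barycentric
coordinates (for this distance `j_σ` is an isometry on the standard simplex of Euclidean
space). -/
def simplexDist {ι : Type*} (X : AbstractSimplicialComplex ι) (σ : Finset ι)
    (x y : X.Realization) : ℝ :=
  √(∑ v ∈ σ, (x.coord v - y.coord v) ^ 2)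

/-- A vertex of `X`, as a point of `|X|`. -/
def vertex {ι : Type*} (X : AbstractSimplicialComplex ι) (v : ι) : X.Realization :=
  { coord := Finsupp.single v 1
    support_mem := by
      rw [Finsupp.support_single _ one_ne_zero]
      exact X.singleton_mem v
    nonneg := fun w => by
      classical
      rw [Finsupp.single_apply]
      split_ifs <;> norm_num
    sum_eq_one := by simp }

theorem vertex_mem_closedSimplex {ι : Type*} (X : AbstractSimplicialComplex ι) {v : ι}
    {σ : Finset ι} (h : v ∈ σ) : X.vertex v ∈ X.closedSimplex σ := by
  intro w hw
  rw [Finset.mem_singleton.1 (Finsupp.support_single_subset hw)]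
  exact h

/-! ### Simplicial paths and their homotopical complexity -/

open Classical in
/-- The graph of vertices and edges of `X`. A simplicial path `(v₀, …, v_k)` is a walk in it. -/
def edgeGraph {ι : Type*} (X : AbstractSimplicialComplex ι) : SimpleGraph ι where
  Adj u v := u ≠ v ∧ ({u, v} : Finset ι) ∈ X.faces
  symm := ⟨fun u v h => ⟨h.1.symm, by rw [Finset.pair_comm]; exact h.2⟩⟩
  loopless := ⟨fun _ h => h.1 rfl⟩

open Classical in
/-- The edge `{u, v}` as a simplex of `X`. -/
def edge {ι : Type*} (X : AbstractSimplicialComplex ι) {u v : ι} (h : X.edgeGraph.Adj u v) :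
    X.faces :=
  ⟨{u, v}, h.2⟩

theorem left_mem_edge {ι : Type*} (X : AbstractSimplicialComplex ι) {u v : ι}
    (h : X.edgeGraph.Adj u v) : u ∈ (X.edge h).1 := by
  simp [edge]

theorem right_mem_edge {ι : Type*} (X : AbstractSimplicialComplex ι) {u v : ι}
    (h : X.edgeGraph.Adj u v) : v ∈ (X.edge h).1 := by
  simp [edge]

/-- The point `(1 - t) u + t v` of the edge `{u, v}`. -/
def edgePoint {ι : Type*} (X : AbstractSimplicialComplex ι) {u v : ι}
    (h : X.edgeGraph.Adj u v) (t : unitInterval) : X.Realization := by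
  classical
  exact X.simplexMap (X.edge h)
    ⟨fun w => if w.1 = u then 1 - (t : ℝ) else t, by
      constructor
      · intro w
        dsimp only
        split_ifs
        · linarith [t.2.2]
        · exact t.2.1
      · rw [Finset.sum_coe_sort (X.edge h).1 (fun w => if w = u then 1 - (t : ℝ) else t)]
        change ∑ w ∈ ({u, v} : Finset ι), (if w = u then 1 - (t : ℝ) else t) = 1
        rw [Finset.sum_pair h.1]
        simp [h.1.symm]⟩

theorem edgePoint_coord {ι : Type*} (X : AbstractSimplicialComplex ι) {u v : ι}
    (h : X.edgeGraph.Adj u v) (t : unitInterval) :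
    (X.edgePoint h t).coord = Finsupp.single u (1 - (t : ℝ)) + Finsupp.single v (t : ℝ) := by
  classical
  ext w
  have hne := h.1
  by_cases hu : w = u
  · subst hu
    simp [edgePoint, simplexMap, X.left_mem_edge h, hne.symm]
  · by_cases hv : w = v
    · subst hv
      simp [edgePoint, simplexMap, X.right_mem_edge h, hu]
    · have : w ∉ (X.edge h).1 := by simp [edge, hu, hv]
      simp [edgePoint, simplexMap, this, Ne.symm hu, Ne.symm hv]

/-- The path `t ↦ (1 - t) u + t v` in `|X|` along an edge `{u, v}`. -/
def edgePath {ι : Type*} (X : AbstractSimplicialComplex ι) {u v : ι}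
    (h : X.edgeGraph.Adj u v) : Path (X.vertex u) (X.vertex v) where
  toFun t := X.edgePoint h t
  continuous_toFun := by
    classical
    refine (X.continuous_simplexMap (X.edge h)).comp (Continuous.subtype_mk ?_ _)
    refine continuous_pi fun w => ?_
    split_ifs <;> fun_prop
  source' := Realization.ext (by rw [edgePoint_coord]; simp [vertex])
  target' := Realization.ext (by rw [edgePoint_coord]; simp [vertex])

/-- The path in `|X|` given by a simplicial path, as a concatenation of edge paths. -/
def walkPath {ι : Type*} (X : AbstractSimplicialComplex ι) :
    {u v : ι} → X.edgeGraph.Walk u v → Path (X.vertex u) (X.vertex v)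
  | _, _, .nil => Path.refl _
  | _, _, .cons h p => (X.edgePath h).trans (X.walkPath p)

/-- A simplicial loop is contractible if the loop in `|X|` that it describes is homotopic,
relative to the endpoints, to the constant loop. -/
def IsContractibleLoop {ι : Type*} (X : AbstractSimplicialComplex ι) {x : ι}
    (Γ : X.edgeGraph.Walk x x) : Prop :=
  (X.walkPath Γ).Homotopic (Path.refl _)

open Classical in
/-- `X.LoopMoves n Γ`: the simplicial loop `Γ` arises from the empty loop by finitely many
insertions and omissions of pieces `(a, b, a)` along edges and of pieces `(a, b, c, a)` around
2-simplices, exactly `n` of these being of the second kind. -/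
inductive LoopMoves {ι : Type*} (X : AbstractSimplicialComplex ι) {x : ι} :
    ℕ → X.edgeGraph.Walk x x → Prop
  | empty : LoopMoves X 0 .nil
  | insertEdge {n : ℕ} {a b : ι} (p : X.edgeGraph.Walk x a) (q : X.edgeGraph.Walk a x)
      (hab : X.edgeGraph.Adj a b) (hba : X.edgeGraph.Adj b a) :
      LoopMoves X n (p.append q) → LoopMoves X n (p.append (.cons hab (.cons hba q)))
  | omitEdge {n : ℕ} {a b : ι} (p : X.edgeGraph.Walk x a) (q : X.edgeGraph.Walk a x)
      (hab : X.edgeGraph.Adj a b) (hba : X.edgeGraph.Adj b a) :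
      LoopMoves X n (p.append (.cons hab (.cons hba q))) → LoopMoves X n (p.append q)
  | insertTriangle {n : ℕ} {a b c : ι} (p : X.edgeGraph.Walk x a) (q : X.edgeGraph.Walk a x)
      (hab : X.edgeGraph.Adj a b) (hbc : X.edgeGraph.Adj b c) (hca : X.edgeGraph.Adj c a)
      (habc : ({a, b, c} : Finset ι) ∈ X.faces) :
      LoopMoves X n (p.append q) →
        LoopMoves X (n + 1) (p.append (.cons hab (.cons hbc (.cons hca q))))
  | omitTriangle {n : ℕ} {a b c : ι} (p : X.edgeGraph.Walk x a) (q : X.edgeGraph.Walk a x)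
      (hab : X.edgeGraph.Adj a b) (hbc : X.edgeGraph.Adj b c) (hca : X.edgeGraph.Adj c a)
      (habc : ({a, b, c} : Finset ι) ∈ X.faces) :
      LoopMoves X n (p.append (.cons hab (.cons hbc (.cons hca q)))) →
        LoopMoves X (n + 1) (p.append q)

/-- The homotopical complexity of a simplicial loop: the minimal number of insertions or
omissions of pieces `(a, b, c, a)` around 2-simplices that is needed to obtain the loop from the
empty loop (`⊤` if the loop cannot be obtained at all). -/
def homotopicalComplexity {ι : Type*} (X : AbstractSimplicialComplex ι) {x : ι}
    (Γ : X.edgeGraph.Walk x x) : ℕ∞ :=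
  ⨅ (n : ℕ) (_ : X.LoopMoves n Γ), (n : ℕ∞)

end AbstractSimplicialComplex

/-! ### Hilbert modules and Hilbert module bundles

Hilbert `A`-modules are Mathlib's `CStarModule A`, for an arbitrary (possibly non-unital)
C*-algebra `A`. Mathlib writes the action of `A` on the left; right Hilbert `A`-modules are the
same thing as left Hilbert modules over the opposite C*-algebra. Completeness of a Hilbert module
that is finitely generated projective follows from completeness of `A^k`. -/

/-- An isomorphism of Hilbert `A`-modules: a bijective (linear, bounded) map which preserves the
`A`-valued inner product. It is automatically adjointable and `A`-linear, see
`HilbertModuleIso.inner_map_left` and `HilbertModuleIso.map_smul_A`. The isomorphisms from `V` to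
itself are exactly the unitary elements of the algebra of adjointable operators on `V`. -/
structure HilbertModuleIso (A V W : Type*)
    [NonUnitalCStarAlgebra A] [PartialOrder A]
    [NormedAddCommGroup V] [NormedSpace ℂ V] [SMul A V] [CStarModule A V]
    [NormedAddCommGroup W] [NormedSpace ℂ W] [SMul A W] [CStarModule A W]
    extends V ≃L[ℂ] W where
  inner_map : ∀ v w : V, ⟪toFun v, toFun w⟫_A = ⟪v, w⟫_A

namespace HilbertModuleIso

variable {A V W : Type*}
  [NonUnitalCStarAlgebra A] [PartialOrder A]
  [NormedAddCommGroup V] [NormedSpace ℂ V] [SMul A V] [CStarModule A V]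
  [NormedAddCommGroup W] [NormedSpace ℂ W] [SMul A W] [CStarModule A W]

/-- The inverse of an isomorphism of Hilbert modules is its adjoint. -/
theorem inner_map_left (f : HilbertModuleIso A V W) (v : V) (w : W) :
    ⟪f.toContinuousLinearEquiv v, w⟫_A = ⟪v, f.toContinuousLinearEquiv.symm w⟫_A := by
  have h := f.inner_map v (f.toContinuousLinearEquiv.symm w)
  rw [← h]
  exact congrArg _ (f.toContinuousLinearEquiv.apply_symm_apply w).symm

theorem map_smul_A (f : HilbertModuleIso A V W) (a : A) (v : V) :
    f.toContinuousLinearEquiv (a • v) = a • f.toContinuousLinearEquiv v := by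
  rw [← sub_eq_zero, ← CStarModule.inner_self (A := A)]
  set d := f.toContinuousLinearEquiv (a • v) - a • f.toContinuousLinearEquiv v with hd
  have key : ∀ w : W, ⟪w, d⟫_A = 0 := by
    intro w
    obtain ⟨u, rfl⟩ := f.toContinuousLinearEquiv.surjective w
    have h1 : ⟪f.toContinuousLinearEquiv u, f.toContinuousLinearEquiv (a • v)⟫_A
        = ⟪u, a • v⟫_A := f.inner_map _ _
    have h2 : ⟪f.toContinuousLinearEquiv u, f.toContinuousLinearEquiv v⟫_A
        = ⟪u, v⟫_A := f.inner_map _ _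
    rw [hd, CStarModule.inner_sub_right, CStarModule.inner_op_smul_right, h1, h2,
      CStarModule.inner_op_smul_right, sub_self]
  exact key d

end HilbertModuleIso

/-- `V` is finitely generated projective: it is isomorphic, as a Hilbert `A`-module, to `p A^k`
for some projection `p = p² = p*` in the adjointable operators of the standard module `A^k`. -/
def IsFinitelyGeneratedProjective (A V : Type*)
    [NonUnitalCStarAlgebra A] [PartialOrder A] [StarOrderedRing A]
    [NormedAddCommGroup V] [NormedSpace ℂ V] [SMul A V] [CStarModule A V] : Prop :=
  ∃ (k : ℕ) (p : WithCStarModule A (Fin k → A) →L[ℂ] WithCStarModule A (Fin k → A))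
    (j : V →ₗ[ℂ] WithCStarModule A (Fin k → A)),
    p ∘L p = p ∧ (∀ x y, ⟪p x, y⟫_A = ⟪x, p y⟫_A) ∧
    Set.range j = Set.range p ∧ ∀ v w, ⟪j v, j w⟫_A = ⟪v, w⟫_A

/-- A Hilbert `A`-module bundle with typical fibre the finitely generated projective Hilbert
`A`-module `V`: a fibre bundle whose fibres are Hilbert `A`-modules, with an atlas of local
trivializations which are isomorphisms of Hilbert `A`-modules on every fibre and whose transition
functions are continuous in the operator norm (part of `VectorBundle`). -/
class IsHilbertModuleBundle (A V : Type*) {B : Type*} (E : B → Type*)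
    [NonUnitalCStarAlgebra A] [PartialOrder A] [StarOrderedRing A]
    [NormedAddCommGroup V] [NormedSpace ℂ V] [SMul A V] [CStarModule A V]
    [∀ b, NormedAddCommGroup (E b)] [∀ b, NormedSpace ℂ (E b)] [∀ b, SMul A (E b)]
    [∀ b, CStarModule A (E b)]
    [TopologicalSpace B] [TopologicalSpace (TotalSpace V E)]
    [FiberBundle V E] [VectorBundle ℂ V E] : Prop where
  fiber_finitelyGeneratedProjective : IsFinitelyGeneratedProjective A V
  inner_trivialization : ∀ (e : Trivialization V (TotalSpace.proj : TotalSpace V E → B))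
    [MemTrivializationAtlas e], ∀ b ∈ e.baseSet, ∀ v w : E b,
      ⟪(e (TotalSpace.mk b v)).2, (e (TotalSpace.mk b w)).2⟫_A = ⟪v, w⟫_A

/-- A trivialization `S × V → E|_S` of a Hilbert `A`-module bundle over a subset `S` of the base:
an isomorphism of Hilbert `A`-modules `V → E_x` for every `x ∈ S`, such that its expressions
`S ∩ U → U(L_A(V))` in the bundle charts `e` over `U` are continuous in the operator norm. -/
structure HilbertTrivializationOn (A V : Type*) {B : Type*} (E : B → Type*)
    [NonUnitalCStarAlgebra A] [PartialOrder A]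
    [NormedAddCommGroup V] [NormedSpace ℂ V] [SMul A V] [CStarModule A V]
    [∀ b, NormedAddCommGroup (E b)] [∀ b, NormedSpace ℂ (E b)] [∀ b, SMul A (E b)]
    [∀ b, CStarModule A (E b)]
    [TopologicalSpace B] [TopologicalSpace (TotalSpace V E)]
    [FiberBundle V E] [VectorBundle ℂ V E] (S : Set B) where
  iso : ∀ x : S, HilbertModuleIso A V (E x)
  continuousOn_iso : ∀ (e : Trivialization V (TotalSpace.proj : TotalSpace V E → B))
    [MemTrivializationAtlas e],
      ContinuousOn
        (fun x : S => e.continuousLinearMapAt ℂ (x : B) ∘L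
          ((iso x).toContinuousLinearEquiv : V →L[ℂ] E x))
        {x : S | (x : B) ∈ e.baseSet}

section Flat

variable {A V : Type*}
  [NonUnitalCStarAlgebra A] [PartialOrder A] [StarOrderedRing A]
  [NormedAddCommGroup V] [NormedSpace ℂ V] [SMul A V] [CStarModule A V]

/-- The transition function `x ↦ Φ(x, ·)⁻¹ ∘ Φ'(x, ·)` on `S`, for trivializations `Φ` over `S` and
`Φ'` over a larger set `S'`. -/
def HilbertTrivializationOn.transition {B : Type*} {E : B → Type*}
    [∀ b, NormedAddCommGroup (E b)] [∀ b, NormedSpace ℂ (E b)] [∀ b, SMul A (E b)]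
    [∀ b, CStarModule A (E b)]
    [TopologicalSpace B] [TopologicalSpace (TotalSpace V E)]
    [FiberBundle V E] [VectorBundle ℂ V E] {S S' : Set B}
    (Φ : HilbertTrivializationOn A V E S) (Φ' : HilbertTrivializationOn A V E S')
    (h : S ⊆ S') (x : S) : V →L[ℂ] V :=
  ((Φ.iso x).toContinuousLinearEquiv.symm : E x →L[ℂ] V) ∘L
    ((Φ'.iso ⟨x, h x.2⟩).toContinuousLinearEquiv : V →L[ℂ] E x)

variable {ι : Type*} {X : AbstractSimplicialComplex ι} {E : X.Realization → Type*}
  [∀ b, NormedAddCommGroup (E b)] [∀ b, NormedSpace ℂ (E b)] [∀ b, SMul A (E b)]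
  [∀ b, CStarModule A (E b)]
  [TopologicalSpace (TotalSpace V E)] [FiberBundle V E] [VectorBundle ℂ V E]

/-- The trivializations `Φ_σ` over the closed simplices form an `ε`-flat family: for simplices
`ρ ⊆ σ` the transition function `Ψ_{ρ ⊆ σ} = Φ_ρ⁻¹ Φ_σ : |ρ| → U(L_A(V))` is `ε`-Lipschitz for the
Euclidean metric of `|ρ|` and the operator norm. -/
def IsFlatFamily (ε : ℝ)
    (Φ : ∀ σ : X.faces, HilbertTrivializationOn A V E (X.closedSimplex σ.1)) : Prop :=
  ∀ (ρ σ : X.faces) (h : ρ.1 ⊆ σ.1) (x y : X.closedSimplex ρ.1),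
    ‖(Φ ρ).transition (Φ σ) (X.closedSimplex_mono h) x
      - (Φ ρ).transition (Φ σ) (X.closedSimplex_mono h) y‖ ≤ ε * X.simplexDist ρ.1 x y

/-- `Φ_X` is a global `ε`-trivialization (relative to the family `Φ_σ`): for every simplex `ρ` the
transition function `Ψ_{ρ ∈ X} = Φ_ρ⁻¹ Φ_X : |ρ| → U(L_A(V))` is `ε`-Lipschitz. -/
def IsGlobalTrivialization (ε : ℝ)
    (Φ : ∀ σ : X.faces, HilbertTrivializationOn A V E (X.closedSimplex σ.1))
    (ΦX : HilbertTrivializationOn A V E (Set.univ : Set X.Realization)) : Prop :=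
  ∀ (ρ : X.faces) (x y : X.closedSimplex ρ.1),
    ‖(Φ ρ).transition ΦX (Set.subset_univ _) x
      - (Φ ρ).transition ΦX (Set.subset_univ _) y‖ ≤ ε * X.simplexDist ρ.1 x y

/-- Transport `T_{(u,v)} = Φ_σ(v, ·) Φ_σ(u, ·)⁻¹ : E_u → E_v` along an edge `σ = {u, v}`. -/
def edgeTransport (Φ : ∀ σ : X.faces, HilbertTrivializationOn A V E (X.closedSimplex σ.1))
    {u v : ι} (h : X.edgeGraph.Adj u v) : E (X.vertex u) ≃L[ℂ] E (X.vertex v) :=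
  (((Φ (X.edge h)).iso ⟨X.vertex u, X.vertex_mem_closedSimplex
      (X.left_mem_edge h)⟩).toContinuousLinearEquiv.symm).trans
    ((Φ (X.edge h)).iso ⟨X.vertex v, X.vertex_mem_closedSimplex
      (X.right_mem_edge h)⟩).toContinuousLinearEquiv

/-- Transport `T_Γ : E_u → E_v` along a simplicial path `Γ` from `u` to `v`. -/
def walkTransport (Φ : ∀ σ : X.faces, HilbertTrivializationOn A V E (X.closedSimplex σ.1)) :
    {u v : ι} → X.edgeGraph.Walk u v → E (X.vertex u) ≃L[ℂ] E (X.vertex v)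
  | _, _, .nil => ContinuousLinearEquiv.refl ℂ _
  | _, _, .cons h p => (edgeTransport Φ h).trans (walkTransport Φ p)

end Flat

end

open Bundle Topology
open scoped InnerProductSpace

noncomputable section

namespace AbstractSimplicialComplex

variable {ι : Type*} (X : AbstractSimplicialComplex ι)

/-! ### The edge-path groupoid -/

/-! Transport. The complexity of a contractible loop is finite because elementary moves generate
homotopy. The edge-path groupoid is the set of walks modulo moves. Its vertex group at the base
point is the discrete fibre of a bundle over `|X|`, with charts over the open stars and transition
functions given by the edges; the 2-simplex relations are exactly the cocycle condition. This is a
covering, and a loop lifts to a path that ends at its class in the edge-path group. A null-homotopic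
loop lifts to a closed path, so its class is trivial (`walkHom_eq_id_of_isContractibleLoop`). Inside
one trivialization `Φ_σ` transport does not depend on the path, and along an edge of `σ` it differs
from `T` by at most `√2 ε`. A triangle move therefore changes `T_Γ` by at most `3√2 ε`, while a
backtrack does not change it (`IsFlatFamily.norm_walkTransport_sub_id_le`).

Trivialization. A frame at a base vertex is transported to all vertices along chosen walks. Its
failure to be parallel along an edge is the holonomy of a contractible loop. There are finitely many
such loops, hence a bound `c ε` depending only on `X`. The frame is then extended over the simplices
by increasing dimension. On the boundary of `σ`, the function `Φ_σ⁻¹ Ψ` is unitary valued with a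
small Lipschitz constant, so after normalization at one point it is close to 1. The inverse Cayley
transform makes it skew-adjoint, radial scaling to zero at the barycentre extends it, and the Cayley
transform returns to unitaries (`exists_unitary_extension`). Each dimension costs a factor that
depends only on the number of vertices (`skeletonConst`). Local Lipschitz control gives continuity
because finitely many closed simplices cover `|X|`.

Distances inside the induction are sup-distances of barycentric coordinates, which do not depend on
the simplex; they are compared with the Euclidean distance only on the way in and on the way out. -/

open Classical in
/-- Elementary homotopies of simplicial paths: omission of a piece `(a, b, a)` along an edge or of
a piece `(a, b, c, a)` around a 2-simplex. -/
inductive ElementaryMove {u v : ι} : X.edgeGraph.Walk u v → X.edgeGraph.Walk u v → Prop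
  | edge {a b : ι} (p : X.edgeGraph.Walk u a) (q : X.edgeGraph.Walk a v)
      (hab : X.edgeGraph.Adj a b) (hba : X.edgeGraph.Adj b a) :
      ElementaryMove (p.append (.cons hab (.cons hba q))) (p.append q)
  | triangle {a b c : ι} (p : X.edgeGraph.Walk u a) (q : X.edgeGraph.Walk a v)
      (hab : X.edgeGraph.Adj a b) (hbc : X.edgeGraph.Adj b c) (hca : X.edgeGraph.Adj c a)
      (habc : ({a, b, c} : Finset ι) ∈ X.faces) :
      ElementaryMove (p.append (.cons hab (.cons hbc (.cons hca q)))) (p.append q)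

variable {X}

theorem ElementaryMove.append_left {u v w : ι} (r : X.edgeGraph.Walk u v)
    {p q : X.edgeGraph.Walk v w} (h : X.ElementaryMove p q) :
    X.ElementaryMove (r.append p) (r.append q) := by
  cases h with
  | edge p q hab hba =>
    rw [SimpleGraph.Walk.append_assoc, SimpleGraph.Walk.append_assoc]
    exact .edge _ _ _ _
  | triangle p q hab hbc hca habc =>
    rw [SimpleGraph.Walk.append_assoc, SimpleGraph.Walk.append_assoc]
    exact .triangle _ _ _ _ _ habc

theorem ElementaryMove.append_right {u v w : ι} {p q : X.edgeGraph.Walk u v}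
    (h : X.ElementaryMove p q) (r : X.edgeGraph.Walk v w) :
    X.ElementaryMove (p.append r) (q.append r) := by
  cases h with
  | edge p q hab hba =>
    rw [← SimpleGraph.Walk.append_assoc, ← SimpleGraph.Walk.append_assoc]
    exact .edge _ _ _ _
  | triangle p q hab hbc hca habc =>
    rw [← SimpleGraph.Walk.append_assoc, ← SimpleGraph.Walk.append_assoc]
    exact .triangle _ _ _ _ _ habc

theorem ElementaryMove.exists_loopMoves_iff {x : ι} {p q : X.edgeGraph.Walk x x}
    (h : X.ElementaryMove p q) : (∃ n, X.LoopMoves n p) ↔ ∃ n, X.LoopMoves n q := by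
  cases h with
  | edge p q hab hba =>
    exact ⟨fun ⟨n, h⟩ => ⟨n, .omitEdge _ _ _ _ h⟩, fun ⟨n, h⟩ => ⟨n, .insertEdge _ _ _ _ h⟩⟩
  | triangle p q hab hbc hca habc =>
    exact ⟨fun ⟨n, h⟩ => ⟨n + 1, .omitTriangle _ _ _ _ _ habc h⟩,
      fun ⟨n, h⟩ => ⟨n + 1, .insertTriangle _ _ _ _ _ habc h⟩⟩

variable (X)

/-- The objects of the edge-path groupoid: the vertices of `X`. -/
def EdgePathGroupoid (_ : AbstractSimplicialComplex ι) : Type _ := ι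

variable {X}

/-- The class of a simplicial path in the edge-path groupoid. -/
def walkClass {u v : ι} (p : X.edgeGraph.Walk u v) : Quot (X.ElementaryMove (u := u) (v := v)) :=
  Quot.mk _ p

theorem walkClass_append_reverse {u v : ι} (p : X.edgeGraph.Walk u v) :
    walkClass (p.append p.reverse) = walkClass .nil := by
  induction p with
  | nil => rfl
  | cons h p ih =>
    rename_i a b c
    -- Conjugating the relation for the tail by the edge `h` leaves only the backtrack along `h`.
    have h1 := congrArg (Quot.map (fun q => SimpleGraph.Walk.cons h (q.append (.cons h.symm .nil)))
      (fun q q' hq => (hq.append_right (.cons h.symm .nil)).append_left (.cons h .nil))) ih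
    refine Eq.trans ?_ (h1.trans (Quot.sound (.edge .nil .nil h h.symm)))
    change walkClass _ = walkClass _
    congr 1
    simp [SimpleGraph.Walk.reverse_cons, SimpleGraph.Walk.append_assoc]

open CategoryTheory

theorem ElementaryMove.reverse {u v : ι} {p q : X.edgeGraph.Walk u v}
    (h : X.ElementaryMove p q) : X.ElementaryMove p.reverse q.reverse := by
  classical
  cases h with
  | edge p q hab hba =>
    simpa [SimpleGraph.Walk.reverse_append, ← SimpleGraph.Walk.append_assoc] using
      ElementaryMove.edge q.reverse p.reverse hab hba
  | triangle p q hab hbc hca habc =>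
    simpa [SimpleGraph.Walk.reverse_append, ← SimpleGraph.Walk.append_assoc] using
      ElementaryMove.triangle q.reverse p.reverse hca.symm hbc.symm hab.symm
        (by convert habc using 1; grind)

theorem walkClass_reverse_append {u v : ι} (p : X.edgeGraph.Walk u v) :
    walkClass (p.reverse.append p) = walkClass .nil := by
  simpa using walkClass_append_reverse p.reverse

instance : Groupoid X.EdgePathGroupoid where
  Hom u v := Quot (X.ElementaryMove (u := u) (v := v))
  id u := walkClass .nil
  comp := Quot.map₂ SimpleGraph.Walk.append (fun p _ _ h => h.append_left p)
    (fun _ _ q h => h.append_right q)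
  inv := Quot.map SimpleGraph.Walk.reverse fun _ _ h => h.reverse
  id_comp := by rintro _ _ ⟨p⟩; rfl
  comp_id := by rintro _ _ ⟨p⟩; exact congrArg walkClass p.append_nil
  assoc := by
    rintro _ _ _ _ ⟨p⟩ ⟨q⟩ ⟨r⟩; exact congrArg walkClass (p.append_assoc q r).symm
  inv_comp := by
    rintro _ _ ⟨p⟩; exact walkClass_reverse_append p
  comp_inv := by rintro _ _ ⟨p⟩; exact walkClass_append_reverse p

/-- A vertex of `X`, as an object of the edge-path groupoid. -/
def edgePathObj (X : AbstractSimplicialComplex ι) (v : ι) : X.EdgePathGroupoid := v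

/-- The morphism of the edge-path groupoid given by a simplicial path. -/
def walkHom {u v : ι} (p : X.edgeGraph.Walk u v) : X.edgePathObj u ⟶ X.edgePathObj v :=
  walkClass p

theorem walkHom_nil (u : ι) : walkHom (.nil : X.edgeGraph.Walk u u) = 𝟙 _ := rfl

theorem walkHom_cons {u v w : ι} (h : X.edgeGraph.Adj u v) (p : X.edgeGraph.Walk v w) :
    walkHom (.cons h p) = walkHom (.cons h .nil) ≫ walkHom p := rfl

/-- Equality in the quotient is a finite zigzag of elementary moves, and each of them preserves
reachability from the empty loop in both directions; only the count grows. -/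
theorem exists_loopMoves_of_walkHom_eq_id {x : ι} {p : X.edgeGraph.Walk x x}
    (h : walkHom p = 𝟙 _) : ∃ n, X.LoopMoves n p := by
  have key : ∀ p q : X.edgeGraph.Walk x x, Relation.EqvGen X.ElementaryMove p q →
      ((∃ n, X.LoopMoves n p) ↔ ∃ n, X.LoopMoves n q) := by
    intro p q h
    induction h with
    | rel _ _ h => exact h.exists_loopMoves_iff
    | refl => rfl
    | symm _ _ _ ih => exact ih.symm
    | trans _ _ _ _ _ ih ih' => exact ih.trans ih'
  exact (key p .nil (Quot.eqvGen_exact h)).2 ⟨0, .empty⟩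

theorem walkHom_triangle {u v w : ι} [DecidableEq ι] (huv : X.edgeGraph.Adj u v)
    (hvw : X.edgeGraph.Adj v w) (huw : X.edgeGraph.Adj u w)
    (h : ({u, v, w} : Finset ι) ∈ X.faces) :
    walkHom (.cons huv .nil) ≫ walkHom (.cons hvw .nil) = walkHom (.cons huw .nil) := by
  have h1 : walkHom (.cons huv (.cons hvw (.cons huw.symm .nil))) = 𝟙 (X.edgePathObj u) :=
    Quot.sound (.triangle .nil .nil huv hvw huw.symm (by convert h))
  have h2 : walkHom (.cons huw.symm (.cons huw .nil)) = 𝟙 (X.edgePathObj w) :=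
    Quot.sound (.edge .nil .nil huw.symm huw)
  rw [walkHom_cons huv, walkHom_cons hvw] at h1
  rw [walkHom_cons] at h2
  calc walkHom (.cons huv .nil) ≫ walkHom (.cons hvw .nil)
      = (walkHom (.cons huv .nil) ≫ walkHom (.cons hvw .nil) ≫ walkHom (.cons huw.symm .nil)) ≫
          walkHom (.cons huw .nil) := by
        rw [Category.assoc, Category.assoc, h2, Category.comp_id]
    _ = walkHom (.cons huw .nil) := by rw [h1, Category.id_comp]

theorem walkHom_backtrack {u v : ι} (huv : X.edgeGraph.Adj u v) (hvu : X.edgeGraph.Adj v u) :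
    walkHom (.cons huv .nil) ≫ walkHom (.cons hvu .nil) = 𝟙 (X.edgePathObj u) :=
  Quot.sound (.edge .nil .nil huv hvu)

theorem edgeGraph_adj_of_mem_face {σ : Finset ι} (hσ : σ ∈ X.faces) {u v : ι} (hu : u ∈ σ)
    (hv : v ∈ σ) (huv : u ≠ v) : X.edgeGraph.Adj u v := by
  classical
  refine ⟨huv, (X.isRelLowerSet_faces hσ).2 ?_ (by simp)⟩
  intro w hw
  simp only [Finset.mem_insert, Finset.mem_singleton] at hw
  rcases hw with rfl | rfl <;> assumption

/-! ### The covering space of `|X|` attached to the edge-path groupoid -/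

variable (x : ι)

/-- A morphism in the edge-path groupoid from the base point to a vertex that can be reached. -/
def baseHom {v : ι} (h : X.edgeGraph.Reachable x v) : X.edgePathObj x ⟶ X.edgePathObj v :=
  walkHom h.some

open Classical in
/-- The action of an edge on the edge-path group, after identifying all the vertices that can be
reached with the base point. -/
def edgeShift (u v : ι) (f : X.edgePathObj x ⟶ X.edgePathObj x) :
    X.edgePathObj x ⟶ X.edgePathObj x :=
  if h : X.edgeGraph.Reachable x u ∧ X.edgeGraph.Adj u v then
    f ≫ baseHom x h.1 ≫ walkHom (.cons h.2 .nil) ≫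
      Groupoid.inv (baseHom x (h.1.trans h.2.reachable))
  else f

variable {x}

theorem edgeShift_of_adj {u v : ι} (hu : X.edgeGraph.Reachable x u) (h : X.edgeGraph.Adj u v)
    (hv : X.edgeGraph.Reachable x v) (f : X.edgePathObj x ⟶ X.edgePathObj x) :
    edgeShift x u v f = f ≫ baseHom x hu ≫ walkHom (.cons h .nil) ≫ Groupoid.inv (baseHom x hv) :=
  dif_pos ⟨hu, h⟩

theorem edgeShift_self (u : ι) (f : X.edgePathObj x ⟶ X.edgePathObj x) :
    edgeShift x u u f = f :=
  dif_neg fun h => h.2.ne rfl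

/-- The cocycle condition on a simplex. The chosen paths to the middle vertex cancel, and the rest
is the triangle relation or, if `u = w`, the backtrack relation. If one vertex is unreachable then
so are its neighbours, and all the shifts are identities. -/
theorem edgeShift_comp {σ : Finset ι} (hσ : σ ∈ X.faces) {u v w : ι} (hu : u ∈ σ) (hv : v ∈ σ)
    (hw : w ∈ σ) (f : X.edgePathObj x ⟶ X.edgePathObj x) :
    edgeShift x v w (edgeShift x u v f) = edgeShift x u w f := by
  classical
  by_cases huv : u = v
  · subst huv; rw [edgeShift_self]
  by_cases hvw : v = w
  · subst hvw; rw [edgeShift_self]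
  have auv := edgeGraph_adj_of_mem_face hσ hu hv huv
  have avw := edgeGraph_adj_of_mem_face hσ hv hw hvw
  by_cases hr : X.edgeGraph.Reachable x u
  · have hrv := hr.trans auv.reachable
    have hrw := hrv.trans avw.reachable
    rw [edgeShift_of_adj hr auv hrv, edgeShift_of_adj hrv avw hrw]
    simp only [Category.assoc]
    rw [← Category.assoc (Groupoid.inv (baseHom x hrv)), Groupoid.inv_comp, Category.id_comp,
      ← Category.assoc (walkHom _) (walkHom _)]
    by_cases huw : u = w
    · subst huw
      rw [walkHom_backtrack, edgeShift_self, Category.id_comp, Groupoid.comp_inv,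
        Category.comp_id]
    · have auw := edgeGraph_adj_of_mem_face hσ hu hw huw
      rw [walkHom_triangle auv avw auw, edgeShift_of_adj hr auw hrw]
      refine (X.isRelLowerSet_faces hσ).2 ?_ (by simp)
      intro a ha
      simp only [Finset.mem_insert, Finset.mem_singleton] at ha
      rcases ha with rfl | rfl | rfl <;> assumption
  · have hrv : ¬ X.edgeGraph.Reachable x v := fun h => hr (h.trans auv.symm.reachable)
    rw [edgeShift, dif_neg fun h => hrv h.1, edgeShift, dif_neg fun h => hr h.1, edgeShift,
      dif_neg fun h => hr h.1]

variable (X) in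
/-- The open star of a vertex. -/
def openStar (v : ι) : Set X.Realization := {y | v ∈ y.coord.support}

theorem continuous_coord (v : ι) : Continuous fun y : X.Realization => y.coord v := by
  classical
  refine continuous_def.2 fun U hU => (X.isOpen_realization_iff _).2 fun σ => ?_
  have : Continuous fun f : stdSimplex ℝ (σ : Finset ι) => (X.simplexMap σ f).coord v := by
    by_cases h : v ∈ (σ : Finset ι)
    · simp only [simplexMap, Finsupp.onFinset_apply, h, dif_pos]
      exact (continuous_apply _).comp continuous_subtype_val
    · simp only [simplexMap, Finsupp.onFinset_apply, h, dif_neg, not_false_eq_true]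
      fun_prop
  exact this.isOpen_preimage U hU

theorem isOpen_openStar (v : ι) : IsOpen (X.openStar v) := by
  have : X.openStar v = (fun y : X.Realization => y.coord v) ⁻¹' {0}ᶜ := by
    ext y; simp [openStar]
  rw [this]
  exact isOpen_compl_singleton.preimage (continuous_coord v)

theorem support_nonempty (y : X.Realization) : y.coord.support.Nonempty :=
  (X.isRelLowerSet_faces y.support_mem).1

instance : TopologicalSpace (X.edgePathObj x ⟶ X.edgePathObj x) := ⊥

instance : DiscreteTopology (X.edgePathObj x ⟶ X.edgePathObj x) := ⟨rfl⟩

variable (X x) in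
/-- The fibre bundle over `|X|` whose fibre is the discrete edge-path group and whose transition
functions between open stars are given by the edges. -/
def edgePathCore : FiberBundleCore ι X.Realization (X.edgePathObj x ⟶ X.edgePathObj x) where
  baseSet := X.openStar
  isOpen_baseSet := isOpen_openStar
  indexAt y := (support_nonempty y).choose
  mem_baseSet_at y := (support_nonempty y).choose_spec
  coordChange u v _ f := edgeShift x u v f
  coordChange_self u _ _ f := edgeShift_self u f
  continuousOn_coordChange u v :=
    ((continuous_of_discreteTopology (f := edgeShift x u v)).comp continuous_snd).continuousOn
  coordChange_comp _ _ _ y hy f := edgeShift_comp y.support_mem hy.1.1 hy.1.2 hy.2 f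

theorem indexAt_mem (y : X.Realization) : (X.edgePathCore x).indexAt y ∈ y.coord.support :=
  (support_nonempty y).choose_spec

/-- The point of the covering space over `y` with coordinate `f` in the chart at `v`. -/
def coverPoint (v : ι) (f : X.edgePathObj x ⟶ X.edgePathObj x) (y : X.Realization) :
    (X.edgePathCore x).TotalSpace :=
  ⟨y, edgeShift x v ((X.edgePathCore x).indexAt y) f⟩

/-- With `f` fixed, this is the constant local section in the chart at `v`. -/
theorem continuousOn_coverPoint (v : ι) (f : X.edgePathObj x ⟶ X.edgePathObj x) :
    ContinuousOn (coverPoint v f) (X.openStar v) := by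
  have h := ((X.edgePathCore x).localTriv v).continuousOn_invFun
  refine h.comp (f := fun y => (y, f)) (Continuous.prodMk_left f).continuousOn ?_
  intro y hy
  rw [Trivialization.target_eq]
  exact ⟨hy, trivial⟩

theorem coverPoint_eq {u v : ι} (f : X.edgePathObj x ⟶ X.edgePathObj x) {y : X.Realization}
    (hu : y ∈ X.openStar u) (hv : y ∈ X.openStar v) :
    coverPoint v (edgeShift x u v f) y = coverPoint u f y :=
  congrArg (TotalSpace.mk y) (edgeShift_comp y.support_mem hu hv (indexAt_mem y) f)

theorem coverPoint_injective {v : ι} {f g : X.edgePathObj x ⟶ X.edgePathObj x}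
    {y : X.Realization} (hy : y ∈ X.openStar v) (h : coverPoint v f y = coverPoint v g y) :
    f = g := by
  have h' : edgeShift x v ((X.edgePathCore x).indexAt y) f
      = edgeShift x v ((X.edgePathCore x).indexAt y) g :=
    eq_of_heq (TotalSpace.mk.inj h).2
  have := congrArg (edgeShift x ((X.edgePathCore x).indexAt y) v) h'
  have hi := indexAt_mem (x := x) y
  rwa [edgeShift_comp y.support_mem hy hi hy, edgeShift_comp y.support_mem hy hi hy,
    edgeShift_self, edgeShift_self] at this

theorem vertex_mem_openStar (v : ι) : X.vertex v ∈ X.openStar v := by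
  simp [openStar, vertex]

/-- The lift of an edge path to the covering space. -/
theorem exists_lift_edgePath {u v : ι} (h : X.edgeGraph.Adj u v)
    (f : X.edgePathObj x ⟶ X.edgePathObj x) :
    ∃ γ : Path (coverPoint u f (X.vertex u)) (coverPoint v (edgeShift x u v f) (X.vertex v)),
      ∀ t, (γ t).proj = X.edgePath h t := by
  classical
  have hu : ∀ t : unitInterval, t ≠ 1 → X.edgePath h t ∈ X.openStar u := by
    intro t ht
    have h1 : (1 : ℝ) - t ≠ 0 := fun h0 => ht (Subtype.ext (sub_eq_zero.1 h0).symm)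
    have : X.edgePath h t = X.edgePoint h t := rfl
    simpa [openStar, this, edgePoint_coord, h.1.symm] using h1
  have hv : ∀ t : unitInterval, t ≠ 0 → X.edgePath h t ∈ X.openStar v := by
    intro t ht
    have : X.edgePath h t = X.edgePoint h t := rfl
    simpa [openStar, this, edgePoint_coord, h.1] using ht
  -- The edge lies in the star of `u` except for its end and in the star of `v` except for its
  -- start. The lift is constant in either chart, and the two descriptions agree on the overlap by
  -- `coverPoint_eq`.
  let γ : unitInterval → (X.edgePathCore x).TotalSpace := fun t =>
    if t = 1 then coverPoint v (edgeShift x u v f) (X.edgePath h t)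
    else coverPoint u f (X.edgePath h t)
  have hγu : ∀ t ≠ 1, γ t = coverPoint u f (X.edgePath h t) := fun t ht => if_neg ht
  have hγv : ∀ t ≠ 0, γ t = coverPoint v (edgeShift x u v f) (X.edgePath h t) := by
    intro t ht
    by_cases h1 : t = 1
    · exact if_pos h1
    · rw [hγu t h1, coverPoint_eq f (hu t h1) (hv t ht)]
  have hc : Continuous γ := by
    rw [continuous_iff_continuousAt]
    intro t
    by_cases h1 : t = 1
    · have ht : t ≠ 0 := by rw [h1]; exact one_ne_zero
      refine ContinuousAt.congr (f := coverPoint v (edgeShift x u v f) ∘ X.edgePath h) ?_ ?_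
      · refine ContinuousAt.comp ?_ (X.edgePath h).continuous.continuousAt
        exact (continuousOn_coverPoint v _).continuousAt
          ((isOpen_openStar v).mem_nhds (hv t ht))
      · filter_upwards [isOpen_ne.mem_nhds ht] with s hs using (hγv s hs).symm
    · refine ContinuousAt.congr (f := coverPoint u f ∘ X.edgePath h) ?_ ?_
      · refine ContinuousAt.comp ?_ (X.edgePath h).continuous.continuousAt
        exact (continuousOn_coverPoint u _).continuousAt
          ((isOpen_openStar u).mem_nhds (hu t h1))
      · filter_upwards [isOpen_ne.mem_nhds h1] with s hs using (hγu s hs).symm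
  refine ⟨⟨⟨γ, hc⟩, ?_, ?_⟩, ?_⟩
  · simp [hγu 0 zero_ne_one]
  · simp [hγv 1 one_ne_zero]
  · intro t
    by_cases h1 : t = 1
    · change (γ t).proj = _
      rw [show γ t = _ from if_pos h1]; rfl
    · change (γ t).proj = _
      rw [hγu t h1]; rfl

/-- Along a lift the groupoid element is multiplied by the class of the walk. The factors
`Groupoid.inv (baseHom x _)` only turn a morphism to a vertex into an element of the vertex group.
-/
theorem exists_lift_walkPath {u v : ι} (p : X.edgeGraph.Walk u v)
    (hu : X.edgeGraph.Reachable x u) (hv : X.edgeGraph.Reachable x v)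
    (f : X.edgePathObj x ⟶ X.edgePathObj u) :
    ∃ γ : Path (coverPoint u (f ≫ Groupoid.inv (baseHom x hu)) (X.vertex u))
        (coverPoint v ((f ≫ walkHom p) ≫ Groupoid.inv (baseHom x hv)) (X.vertex v)),
      ∀ t, (γ t).proj = X.walkPath p t := by
  induction p with
  | nil =>
    rw [walkHom_nil, Category.comp_id]
    exact ⟨Path.refl _, fun t => rfl⟩
  | cons h p ih =>
    rename_i a b c
    have hw := hu.trans h.reachable
    obtain ⟨γ₁, h₁⟩ := exists_lift_edgePath (x := x) h (f ≫ Groupoid.inv (baseHom x hu))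
    obtain ⟨γ₂, h₂⟩ := ih hw hv (f ≫ walkHom (.cons h .nil))
    have e : edgeShift x a b (f ≫ Groupoid.inv (baseHom x hu))
        = (f ≫ walkHom (.cons h .nil)) ≫ Groupoid.inv (baseHom x hw) := by
      rw [edgeShift_of_adj hu h hw]
      simp only [Category.assoc]
      rw [← Category.assoc (Groupoid.inv _) (baseHom x hu), Groupoid.inv_comp, Category.id_comp]
    -- The endpoint occurs in the type of `γ₁`, so `e` can be rewritten only with `γ₁` generalized.
    revert γ₁
    rw [e]
    intro γ₁ h₁
    rw [walkHom_cons, ← Category.assoc]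
    refine ⟨γ₁.trans γ₂, fun t => ?_⟩
    rw [walkPath, Path.trans_apply, Path.trans_apply]
    split_ifs
    · exact h₁ _
    · exact h₂ _

/-- Homotopic paths have lifts with the same end, so the lift of `p` ends where the constant lift
does. Comparing fibre coordinates in the chart at `x` and cancelling `baseHom` gives the claim. -/
theorem walkHom_eq_id_of_isContractibleLoop {p : X.edgeGraph.Walk x x}
    (h : X.IsContractibleLoop p) : walkHom p = 𝟙 _ := by
  have hx : X.edgeGraph.Reachable x x := .refl _
  obtain ⟨γ, hγ⟩ := exists_lift_walkPath p hx hx (𝟙 _)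
  have cov : IsCoveringMap (TotalSpace.proj : (X.edgePathCore x).TotalSpace → X.Realization) :=
    FiberBundle.isCoveringMap
  have h1 := cov.liftPath_apply_one_eq_of_homotopicRel h
    (coverPoint x (𝟙 _ ≫ Groupoid.inv (baseHom x hx)) (X.vertex x))
    (by simp; rfl) (by simp; rfl)
  rw [← (cov.eq_liftPath_iff' (Γ := γ) _).2 ⟨funext hγ, by simp⟩] at h1
  have h2 := cov.liftPath_const (e := coverPoint x (𝟙 _ ≫ Groupoid.inv (baseHom x hx))
    (X.vertex x)) (x := X.vertex x) rfl
  have h3 := h1.trans (congrArg (fun g : C(unitInterval, _) => g 1) h2)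
  have h4 := coverPoint_injective (vertex_mem_openStar x) ((γ.target.symm.trans h3))
  rw [Category.id_comp] at h4
  have h5 := congrArg (· ≫ baseHom x hx) h4
  simpa using h5

theorem exists_loopMoves_of_isContractibleLoop {p : X.edgeGraph.Walk x x}
    (h : X.IsContractibleLoop p) : ∃ n, X.LoopMoves n p :=
  exists_loopMoves_of_walkHom_eq_id (walkHom_eq_id_of_isContractibleLoop h)

theorem exists_loopMoves_eq_homotopicalComplexity {p : X.edgeGraph.Walk x x}
    (h : X.IsContractibleLoop p) :
    ∃ n : ℕ, X.homotopicalComplexity p = n ∧ X.LoopMoves n p := by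
  classical
  have hex := exists_loopMoves_of_isContractibleLoop h
  refine ⟨Nat.find hex, le_antisymm (iInf₂_le (Nat.find hex) (Nat.find_spec hex)) ?_,
    Nat.find_spec hex⟩
  exact le_iInf₂ fun m hm => Nat.cast_le.2 (Nat.find_min' hex hm)

end AbstractSimplicialComplex

/-! ### Contractions -/

/-- For contractions, errors add up under composition instead of being multiplied by norms. -/
theorem norm_comp_sub_comp_le {V W U : Type*} [NormedAddCommGroup V] [NormedSpace ℂ V]
    [NormedAddCommGroup W] [NormedSpace ℂ W] [NormedAddCommGroup U] [NormedSpace ℂ U]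
    {S T : V →L[ℂ] W} {S' T' : W →L[ℂ] U} (hT : ‖T'‖ ≤ 1) (hS : ‖S‖ ≤ 1) :
    ‖T' ∘L T - S' ∘L S‖ ≤ ‖T' - S'‖ + ‖T - S‖ := by
  have h : T' ∘L T - S' ∘L S = T' ∘L (T - S) + (T' - S') ∘L S := by
    simp [ContinuousLinearMap.comp_sub, ContinuousLinearMap.sub_comp]
  rw [h, add_comm]
  refine (norm_add_le _ _).trans (add_le_add ?_ ?_)
  · exact (ContinuousLinearMap.opNorm_comp_le _ _).trans
      (mul_le_of_le_one_right (norm_nonneg _) hS)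
  · exact (ContinuousLinearMap.opNorm_comp_le _ _).trans
      (mul_le_of_le_one_left (norm_nonneg _) hT)

theorem norm_comp_comp_le {V W U Z : Type*} [NormedAddCommGroup V] [NormedSpace ℂ V]
    [NormedAddCommGroup W] [NormedSpace ℂ W] [NormedAddCommGroup U] [NormedSpace ℂ U]
    [NormedAddCommGroup Z] [NormedSpace ℂ Z]
    {R : V →L[ℂ] W} {S : W →L[ℂ] U} {T : U →L[ℂ] Z} (hT : ‖T‖ ≤ 1) (hR : ‖R‖ ≤ 1) :
    ‖T ∘L S ∘L R‖ ≤ ‖S‖ :=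
  (ContinuousLinearMap.opNorm_comp_le _ _).trans <|
    (mul_le_of_le_one_left (norm_nonneg _) hT).trans <|
      (ContinuousLinearMap.opNorm_comp_le _ _).trans (mul_le_of_le_one_right (norm_nonneg _) hR)

namespace HilbertModuleIso

variable {A V W U : Type*}
  [NonUnitalCStarAlgebra A] [PartialOrder A]
  [NormedAddCommGroup V] [NormedSpace ℂ V] [SMul A V] [CStarModule A V]
  [NormedAddCommGroup W] [NormedSpace ℂ W] [SMul A W] [CStarModule A W]
  [NormedAddCommGroup U] [NormedSpace ℂ U] [SMul A U] [CStarModule A U]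

theorem inner_apply_apply (f : HilbertModuleIso A V W) (v w : V) :
    ⟪f.toContinuousLinearEquiv v, f.toContinuousLinearEquiv w⟫_A = ⟪v, w⟫_A :=
  f.inner_map v w

theorem norm_apply (f : HilbertModuleIso A V W) (v : V) : ‖f.toContinuousLinearEquiv v‖ = ‖v‖ := by
  rw [CStarModule.norm_eq_sqrt_norm_inner_self (A := A),
    CStarModule.norm_eq_sqrt_norm_inner_self (A := A) v, inner_apply_apply]

/-- The inverse of an isomorphism of Hilbert modules. -/
def symm (f : HilbertModuleIso A V W) : HilbertModuleIso A W V where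
  toContinuousLinearEquiv := f.toContinuousLinearEquiv.symm
  inner_map v w := by
    refine (f.inner_apply_apply _ _).symm.trans ?_
    exact congrArg₂ _ (f.toContinuousLinearEquiv.apply_symm_apply v)
      (f.toContinuousLinearEquiv.apply_symm_apply w)

/-- The composition of isomorphisms of Hilbert modules. -/
def trans (f : HilbertModuleIso A V W) (g : HilbertModuleIso A W U) : HilbertModuleIso A V U where
  toContinuousLinearEquiv := f.toContinuousLinearEquiv.trans g.toContinuousLinearEquiv
  inner_map _ _ := (g.inner_apply_apply _ _).trans (f.inner_apply_apply _ _)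

variable (A V) in
/-- The identity of a Hilbert module. -/
def refl : HilbertModuleIso A V V where
  toContinuousLinearEquiv := ContinuousLinearEquiv.refl ℂ V
  inner_map _ _ := rfl

theorem norm_le_one (f : HilbertModuleIso A V W) :
    ‖(f.toContinuousLinearEquiv : V →L[ℂ] W)‖ ≤ 1 :=
  ContinuousLinearMap.opNorm_le_bound _ zero_le_one fun v => by
    rw [one_mul]; exact (f.norm_apply v).le

theorem norm_symm_le_one (f : HilbertModuleIso A V W) :
    ‖(f.toContinuousLinearEquiv.symm : W →L[ℂ] V)‖ ≤ 1 :=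
  f.symm.norm_le_one

end HilbertModuleIso

/-! ### Transport in flat bundles -/

section Transport

variable {A V : Type*}
  [NonUnitalCStarAlgebra A] [PartialOrder A]
  [NormedAddCommGroup V] [NormedSpace ℂ V] [SMul A V] [CStarModule A V]
  {ι : Type*} {X : AbstractSimplicialComplex ι} {E : X.Realization → Type*}
  [∀ b, NormedAddCommGroup (E b)] [∀ b, NormedSpace ℂ (E b)] [∀ b, SMul A (E b)]
  [∀ b, CStarModule A (E b)]
  [TopologicalSpace (TotalSpace V E)] [FiberBundle V E] [VectorBundle ℂ V E]

/-- Transport from `u` to `v` in the trivialization over a simplex `σ` that contains them. -/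
def simplexTransport (Φ : ∀ σ : X.faces, HilbertTrivializationOn A V E (X.closedSimplex σ.1))
    (σ : X.faces) {u v : ι} (hu : u ∈ σ.1) (hv : v ∈ σ.1) :
    HilbertModuleIso A (E (X.vertex u)) (E (X.vertex v)) :=
  ((Φ σ).iso ⟨X.vertex u, X.vertex_mem_closedSimplex hu⟩).symm.trans
    ((Φ σ).iso ⟨X.vertex v, X.vertex_mem_closedSimplex hv⟩)

variable (Φ : ∀ σ : X.faces, HilbertTrivializationOn A V E (X.closedSimplex σ.1))

theorem edgeTransport_eq_simplexTransport {u v : ι} (h : X.edgeGraph.Adj u v) {σ : X.faces}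
    (hσ : X.edge h = σ) (hu : u ∈ σ.1) (hv : v ∈ σ.1) :
    edgeTransport Φ h = (simplexTransport Φ σ hu hv).toContinuousLinearEquiv := by
  subst hσ
  rfl

theorem edgeTransport_symm {u v : ι} (h : X.edgeGraph.Adj u v) (h' : X.edgeGraph.Adj v u) :
    edgeTransport Φ h' = (edgeTransport Φ h).symm := by
  have he : X.edge h' = X.edge h := by
    classical exact Subtype.ext (Finset.pair_comm _ _)
  rw [edgeTransport_eq_simplexTransport Φ h' he (X.right_mem_edge h) (X.left_mem_edge h)]
  rfl

/-- Transport along a simplicial path is an isomorphism of Hilbert modules. -/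
def walkTransportIso : {u v : ι} → X.edgeGraph.Walk u v →
    HilbertModuleIso A (E (X.vertex u)) (E (X.vertex v))
  | _, _, .nil => .refl A _
  | _, _, .cons h p =>
    (simplexTransport Φ (X.edge h) (X.left_mem_edge h) (X.right_mem_edge h)).trans
      (walkTransportIso p)

theorem toContinuousLinearEquiv_walkTransportIso {u v : ι} (p : X.edgeGraph.Walk u v) :
    (walkTransportIso Φ p).toContinuousLinearEquiv = walkTransport Φ p := by
  induction p with
  | nil => rfl
  | cons h p ih => exact congrArg (edgeTransport Φ h).trans ih

theorem norm_walkTransport_le {u v : ι} (p : X.edgeGraph.Walk u v) :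
    ‖(walkTransport Φ p : E (X.vertex u) →L[ℂ] E (X.vertex v))‖ ≤ 1 := by
  rw [← toContinuousLinearEquiv_walkTransportIso]
  exact HilbertModuleIso.norm_le_one _

theorem walkTransport_append {u v w : ι} (p : X.edgeGraph.Walk u v) (q : X.edgeGraph.Walk v w) :
    walkTransport Φ (p.append q) = (walkTransport Φ p).trans (walkTransport Φ q) := by
  induction p with
  | nil => rfl
  | cons h p ih => exact congrArg (edgeTransport Φ h).trans (ih q)

theorem walkTransport_reverse {u v : ι} (p : X.edgeGraph.Walk u v) :
    walkTransport Φ p.reverse = (walkTransport Φ p).symm := by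
  induction p with
  | nil => rfl
  | cons h p ih =>
    rw [SimpleGraph.Walk.reverse_cons, walkTransport_append, ih]
    ext y
    simp [walkTransport, edgeTransport_symm Φ h h.symm]

variable {Φ}

theorem simplexDist_vertex {u v : ι} (h : X.edgeGraph.Adj u v) :
    X.simplexDist (X.edge h).1 (X.vertex u) (X.vertex v) = √2 := by
  classical
  have hd : (X.edge h).1 = {u, v} := by simp [AbstractSimplicialComplex.edge]
  have := h.1
  rw [AbstractSimplicialComplex.simplexDist, hd, Finset.sum_pair h.1]
  simp [AbstractSimplicialComplex.vertex, h.1, h.1.symm]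
  norm_num

/-- With `Ψ = Φ_e⁻¹ Φ_σ` the difference equals `Φ_e(v) (Ψ(u) - Ψ(v)) Φ_σ(u)⁻¹`. The outer factors
are isometries, and the edge has length `√2`. -/
theorem IsFlatFamily.norm_edgeTransport_sub_le {ε : ℝ} [StarOrderedRing A] (hΦ : IsFlatFamily ε Φ)
    (σ : X.faces) {u v : ι} (h : X.edgeGraph.Adj u v) (hσ : (X.edge h).1 ⊆ σ.1) :
    ‖(edgeTransport Φ h : E (X.vertex u) →L[ℂ] E (X.vertex v)) -
      ((simplexTransport Φ σ (hσ (X.left_mem_edge h))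
        (hσ (X.right_mem_edge h))).toContinuousLinearEquiv : _ →L[ℂ] _)‖ ≤ √2 * ε := by
  let a : X.closedSimplex (X.edge h).1 :=
    ⟨X.vertex u, X.vertex_mem_closedSimplex (X.left_mem_edge h)⟩
  let b : X.closedSimplex (X.edge h).1 :=
    ⟨X.vertex v, X.vertex_mem_closedSimplex (X.right_mem_edge h)⟩
  have h1 := hΦ (X.edge h) σ hσ a b
  rw [show X.simplexDist (X.edge h).1 a b = √2 from simplexDist_vertex h, mul_comm] at h1
  refine le_trans ?_ h1
  refine Eq.trans_le ?_ (norm_comp_comp_le (T := (((Φ (X.edge h)).iso b).toContinuousLinearEquiv :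
      V →L[ℂ] E (X.vertex v))) (R := (((Φ σ).iso ⟨X.vertex u, X.vertex_mem_closedSimplex
        (hσ (X.left_mem_edge h))⟩).toContinuousLinearEquiv.symm : E (X.vertex u) →L[ℂ] V))
      (HilbertModuleIso.norm_le_one _) (HilbertModuleIso.norm_symm_le_one _))
  congr 1
  ext y
  simp [HilbertTrivializationOn.transition, edgeTransport, simplexTransport, a, b,
    HilbertModuleIso.trans, HilbertModuleIso.symm]

variable (Φ) in
theorem norm_edgeTransport_le {u v : ι} (h : X.edgeGraph.Adj u v) :
    ‖(edgeTransport Φ h : E (X.vertex u) →L[ℂ] E (X.vertex v))‖ ≤ 1 := by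
  rw [edgeTransport_eq_simplexTransport Φ h rfl (X.left_mem_edge h) (X.right_mem_edge h)]
  exact HilbertModuleIso.norm_le_one _

theorem simplexTransport_comp (σ : X.faces) {u v w : ι} (hu : u ∈ σ.1) (hv : v ∈ σ.1)
    (hw : w ∈ σ.1) :
    ((simplexTransport Φ σ hv hw).toContinuousLinearEquiv :
        E (X.vertex v) →L[ℂ] E (X.vertex w)) ∘L
      ((simplexTransport Φ σ hu hv).toContinuousLinearEquiv :
        E (X.vertex u) →L[ℂ] E (X.vertex v)) =
    ((simplexTransport Φ σ hu hw).toContinuousLinearEquiv :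
        E (X.vertex u) →L[ℂ] E (X.vertex w)) := by
  ext y
  simp [simplexTransport, HilbertModuleIso.trans, HilbertModuleIso.symm]

theorem simplexTransport_self (σ : X.faces) {u : ι} (hu : u ∈ σ.1) :
    ((simplexTransport Φ σ hu hu).toContinuousLinearEquiv :
        E (X.vertex u) →L[ℂ] E (X.vertex u)) = ContinuousLinearMap.id ℂ _ := by
  ext y
  simp [simplexTransport, HilbertModuleIso.trans, HilbertModuleIso.symm]

/-- Transport around the triangle within `Φ_σ` is the identity; replacing its three edges by their
own trivializations costs `√2 ε` each. -/
theorem IsFlatFamily.norm_triangleTransport_sub_id_le {ε : ℝ} [StarOrderedRing A]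
    (hΦ : IsFlatFamily ε Φ)
    {a b c : ι} [DecidableEq ι] (hab : X.edgeGraph.Adj a b) (hbc : X.edgeGraph.Adj b c)
    (hca : X.edgeGraph.Adj c a) (habc : ({a, b, c} : Finset ι) ∈ X.faces) :
    ‖(walkTransport Φ (.cons hab (.cons hbc (.cons hca .nil))) :
        E (X.vertex a) →L[ℂ] E (X.vertex a)) - ContinuousLinearMap.id ℂ _‖ ≤ 3 * √2 * ε := by
  obtain ⟨σ, hσ⟩ : ∃ σ : X.faces, σ.1 = {a, b, c} := ⟨⟨_, habc⟩, rfl⟩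
  have ha : a ∈ σ.1 := by simp [hσ]
  have hb : b ∈ σ.1 := by simp [hσ]
  have hc : c ∈ σ.1 := by simp [hσ]
  have sub : ∀ {u v : ι} (h : X.edgeGraph.Adj u v), u ∈ σ.1 → v ∈ σ.1 → (X.edge h).1 ⊆ σ.1 := by
    intro u v h hu hv w hw
    simp only [AbstractSimplicialComplex.edge, Finset.mem_insert, Finset.mem_singleton] at hw
    rcases hw with rfl | rfl <;> assumption
  have h1 := hΦ.norm_edgeTransport_sub_le σ hab (sub hab ha hb)
  have h2 := hΦ.norm_edgeTransport_sub_le σ hbc (sub hbc hb hc)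
  have h3 := hΦ.norm_edgeTransport_sub_le σ hca (sub hca hc ha)
  have e' : (walkTransport Φ (.cons hab (.cons hbc (.cons hca .nil))) :
        E (X.vertex a) →L[ℂ] E (X.vertex a)) =
      (edgeTransport Φ hca : E (X.vertex c) →L[ℂ] E (X.vertex a)) ∘L
      ((edgeTransport Φ hbc : E (X.vertex b) →L[ℂ] E (X.vertex c)) ∘L
      (edgeTransport Φ hab : E (X.vertex a) →L[ℂ] E (X.vertex b))) := rfl
  rw [e', ← simplexTransport_self (Φ := Φ) σ ha, ← simplexTransport_comp (Φ := Φ) σ ha hc ha,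
    ← simplexTransport_comp (Φ := Φ) σ ha hb hc]
  refine (norm_comp_sub_comp_le (norm_edgeTransport_le Φ hca) ?_).trans ?_
  · rw [simplexTransport_comp]
    exact HilbertModuleIso.norm_le_one _
  · have h4 := norm_comp_sub_comp_le (T := (edgeTransport Φ hab : E (X.vertex a) →L[ℂ] _))
      (S' := ((simplexTransport Φ σ hb hc).toContinuousLinearEquiv :
        E (X.vertex b) →L[ℂ] E (X.vertex c)))
      (norm_edgeTransport_le Φ hbc) (simplexTransport Φ σ ha hb).norm_le_one
    refine (add_le_add h3 (h4.trans (add_le_add h2 h1))).trans_eq (by ring)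

theorem IsFlatFamily.norm_append_sub_append_le {ε : ℝ} [StarOrderedRing A] (hΦ : IsFlatFamily ε Φ)
    {x a b c : ι} [DecidableEq ι] (p : X.edgeGraph.Walk x a) (q : X.edgeGraph.Walk a x)
    (hab : X.edgeGraph.Adj a b) (hbc : X.edgeGraph.Adj b c)
    (hca : X.edgeGraph.Adj c a) (habc : ({a, b, c} : Finset ι) ∈ X.faces) :
    ‖(walkTransport Φ (p.append (.cons hab (.cons hbc (.cons hca q)))) :
        E (X.vertex x) →L[ℂ] E (X.vertex x)) - (walkTransport Φ (p.append q) : _ →L[ℂ] _)‖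
      ≤ 3 * √2 * ε := by
  refine le_trans ?_ (hΦ.norm_triangleTransport_sub_id_le hab hbc hca habc)
  refine Eq.trans_le ?_ (norm_comp_comp_le (norm_walkTransport_le Φ q) (norm_walkTransport_le Φ p))
  congr 1
  ext y
  simp [walkTransport_append, walkTransport]

theorem walkTransport_append_backtrack {x a b : ι} (p : X.edgeGraph.Walk x a)
    (q : X.edgeGraph.Walk a x) (hab : X.edgeGraph.Adj a b) (hba : X.edgeGraph.Adj b a) :
    walkTransport Φ (p.append (.cons hab (.cons hba q))) = walkTransport Φ (p.append q) := by
  ext y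
  simp [walkTransport_append, walkTransport, edgeTransport_symm Φ hab hba]

/-- Insertions and omissions of backtracks leave the transport unchanged, and every counted move
contributes one triangle error, so no smallness of `ε` is needed. -/
theorem IsFlatFamily.norm_walkTransport_sub_id_le {ε : ℝ} [StarOrderedRing A]
    (hΦ : IsFlatFamily ε Φ) {x : ι} {n : ℕ} {p : X.edgeGraph.Walk x x} (h : X.LoopMoves n p) :
    ‖(walkTransport Φ p : E (X.vertex x) →L[ℂ] E (X.vertex x)) - ContinuousLinearMap.id ℂ _‖
      ≤ 3 * √2 * n * ε := by
  classical
  induction h with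
  | empty => simp [walkTransport]
  | insertEdge p q hab hba _ ih => rwa [walkTransport_append_backtrack]
  | omitEdge p q hab hba _ ih => rwa [walkTransport_append_backtrack] at ih
  | insertTriangle p q hab hbc hca habc _ ih =>
    have h1 := hΦ.norm_append_sub_append_le p q hab hbc hca (by convert habc)
    have h2 := norm_sub_le_norm_sub_add_norm_sub
      (walkTransport Φ (p.append (.cons hab (.cons hbc (.cons hca q)))) :
        E (X.vertex x) →L[ℂ] E (X.vertex x)) (walkTransport Φ (p.append q) : _ →L[ℂ] _)
        (ContinuousLinearMap.id ℂ _)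
    push_cast
    linarith
  | omitTriangle p q hab hbc hca habc _ ih =>
    have h1 := hΦ.norm_append_sub_append_le p q hab hbc hca (by convert habc)
    rw [norm_sub_rev] at h1
    have h2 := norm_sub_le_norm_sub_add_norm_sub (walkTransport Φ (p.append q) : _ →L[ℂ] _)
      (walkTransport Φ (p.append (.cons hab (.cons hbc (.cons hca q)))) :
        E (X.vertex x) →L[ℂ] E (X.vertex x))
        (ContinuousLinearMap.id ℂ _)
    push_cast
    linarith

end Transport

/-! ### Completeness of finitely generated projective Hilbert modules -/

/-- `V` is isometric to the range of an idempotent, that is, to its closed set of fixed points in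
the complete space `A^k`. Completeness makes `1 - a` invertible for small `a` in the Cayley
transform. -/
theorem IsFinitelyGeneratedProjective.completeSpace {A V : Type*}
    [NonUnitalCStarAlgebra A] [PartialOrder A] [StarOrderedRing A]
    [NormedAddCommGroup V] [NormedSpace ℂ V] [SMul A V] [CStarModule A V]
    (h : IsFinitelyGeneratedProjective A V) : CompleteSpace V := by
  obtain ⟨k, p, j, hp, -, hj, hinner⟩ := h
  have hnorm : ∀ v, ‖j v‖ = ‖v‖ := fun v => by
    rw [CStarModule.norm_eq_sqrt_norm_inner_self (A := A) v,
      CStarModule.norm_eq_sqrt_norm_inner_self (A := A) (j v), hinner]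
  let J : V →ₗᵢ[ℂ] WithCStarModule A (Fin k → A) := ⟨j, hnorm⟩
  refine (completeSpace_iff_isComplete_range J.isometry.isUniformInducing).2 ?_
  have hr : Set.range J = {x | p x = x} := by
    refine Eq.trans hj (Set.ext fun x => ⟨?_, fun hx => ⟨x, hx⟩⟩)
    rintro ⟨y, rfl⟩
    exact congrArg (fun q => q y) hp
  rw [hr]
  exact (isClosed_eq p.continuous continuous_id).isComplete

/-! ### The Cayley transform -/

section Cayley

variable {V : Type*} [NormedAddCommGroup V] [NormedSpace ℂ V]

/-- The resolvent `(1 - a)⁻¹`. -/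
def oneSubInv (a : V →L[ℂ] V) : V →L[ℂ] V := Ring.inverse (1 - a)

/-- The Cayley transform `(1 + a) (1 - a)⁻¹`. -/
def cayley (a : V →L[ℂ] V) : V →L[ℂ] V := 2 • oneSubInv a - 1

/-- The inverse Cayley transform `(u - 1) (u + 1)⁻¹`. -/
def cayleyInv (u : V →L[ℂ] V) : V →L[ℂ] V := 1 - oneSubInv ((2⁻¹ : ℝ) • (1 - u))

theorem oneSubInv_zero : oneSubInv (0 : V →L[ℂ] V) = 1 := by
  simp [oneSubInv]

theorem norm_half_smul_le {u : V →L[ℂ] V} (hu : ‖u - 1‖ ≤ 1 / 4) :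
    ‖(2⁻¹ : ℝ) • (1 - u)‖ ≤ 1 / 2 := by
  rw [norm_smul, norm_sub_rev]
  norm_num
  linarith [norm_nonneg (u - 1)]

variable [CompleteSpace V]

theorem isUnit_one_sub {a : V →L[ℂ] V} (ha : ‖a‖ ≤ 1 / 2) : IsUnit (1 - a) :=
  isUnit_one_sub_of_norm_lt_one (ha.trans_lt (by norm_num))

theorem oneSubInv_mul {a : V →L[ℂ] V} (ha : ‖a‖ ≤ 1 / 2) : oneSubInv a * (1 - a) = 1 :=
  Ring.inverse_mul_cancel _ (isUnit_one_sub ha)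

theorem mul_oneSubInv {a : V →L[ℂ] V} (ha : ‖a‖ ≤ 1 / 2) : (1 - a) * oneSubInv a = 1 :=
  Ring.mul_inverse_cancel _ (isUnit_one_sub ha)

theorem norm_oneSubInv_le {a : V →L[ℂ] V} (ha : ‖a‖ ≤ 1 / 2) : ‖oneSubInv a‖ ≤ 2 := by
  have h : oneSubInv a = 1 + a * oneSubInv a := by
    have := mul_oneSubInv ha
    rw [sub_mul, one_mul] at this
    rw [← this, sub_add_cancel]
  have h1 : ‖oneSubInv a‖ ≤ 1 + 1 / 2 * ‖oneSubInv a‖ := by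
    calc ‖oneSubInv a‖ = ‖1 + a * oneSubInv a‖ := congrArg _ h
      _ ≤ ‖(1 : V →L[ℂ] V)‖ + ‖a * oneSubInv a‖ := norm_add_le _ _
      -- Only `‖1‖ ≤ 1` is available, since `V` may be zero.
      _ ≤ 1 + 1 / 2 * ‖oneSubInv a‖ := add_le_add ContinuousLinearMap.norm_id_le
        ((norm_mul_le _ _).trans (mul_le_mul_of_nonneg_right ha (norm_nonneg _)))
  linarith

theorem norm_oneSubInv_sub_le {a b : V →L[ℂ] V} (ha : ‖a‖ ≤ 1 / 2) (hb : ‖b‖ ≤ 1 / 2) :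
    ‖oneSubInv a - oneSubInv b‖ ≤ 4 * ‖a - b‖ := by
  have h : oneSubInv a - oneSubInv b = oneSubInv a * (a - b) * oneSubInv b := by
    have h1 : a - b = (1 - b) - (1 - a) := by abel
    rw [h1, mul_sub, oneSubInv_mul ha, sub_mul, mul_assoc, mul_oneSubInv hb, mul_one, one_mul]
  rw [h]
  calc _ ≤ ‖oneSubInv a‖ * ‖a - b‖ * ‖oneSubInv b‖ := norm_mul₃_le
    _ ≤ 2 * ‖a - b‖ * 2 := by
      gcongr
      · exact norm_oneSubInv_le ha
      · exact norm_oneSubInv_le hb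
    _ = _ := by ring

theorem norm_cayley_sub_le {a b : V →L[ℂ] V} (ha : ‖a‖ ≤ 1 / 2) (hb : ‖b‖ ≤ 1 / 2) :
    ‖cayley a - cayley b‖ ≤ 8 * ‖a - b‖ := by
  have h : cayley a - cayley b = 2 • (oneSubInv a - oneSubInv b) := by
    simp only [cayley, smul_sub]; abel
  rw [h]
  refine (norm_nsmul_le).trans ?_
  push_cast
  linarith [norm_oneSubInv_sub_le ha hb]

theorem norm_cayleyInv_sub_le {u v : V →L[ℂ] V} (hu : ‖u - 1‖ ≤ 1 / 4) (hv : ‖v - 1‖ ≤ 1 / 4) :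
    ‖cayleyInv u - cayleyInv v‖ ≤ 2 * ‖u - v‖ := by
  rw [cayleyInv, cayleyInv, sub_sub_sub_cancel_left]
  refine (norm_oneSubInv_sub_le (norm_half_smul_le hv) (norm_half_smul_le hu)).trans_eq ?_
  rw [← smul_sub, sub_sub_sub_cancel_left, norm_smul]
  norm_num
  ring

theorem norm_cayleyInv_le {u : V →L[ℂ] V} (hu : ‖u - 1‖ ≤ 1 / 4) :
    ‖cayleyInv u‖ ≤ 2 * ‖u - 1‖ := by
  have := norm_cayleyInv_sub_le hu (v := 1) (by simp)
  rwa [show cayleyInv (1 : V →L[ℂ] V) = 0 by simp [cayleyInv, oneSubInv_zero], sub_zero] at this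

theorem cayley_cayleyInv {u : V →L[ℂ] V} (hu : ‖u - 1‖ ≤ 1 / 4) : cayley (cayleyInv u) = u := by
  have ha : ‖cayleyInv u‖ ≤ 1 / 2 := (norm_cayleyInv_le hu).trans (by linarith)
  have h1 := oneSubInv_mul ha
  -- Thus `1 - cayleyInv u` is inverse to `(1 + u) / 2`, whose double minus 1 is `u`.
  rw [show (1 : V →L[ℂ] V) - cayleyInv u = oneSubInv ((2⁻¹ : ℝ) • (1 - u)) from
    sub_sub_cancel _ _] at h1
  have h2 := left_inv_eq_right_inv h1 (oneSubInv_mul (norm_half_smul_le hu))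
  rw [cayley, h2]
  ext v
  simp only [two_smul, sub_apply, add_apply,
    one_apply_eq_self, smul_apply]
  module

theorem cayley_eq {a : V →L[ℂ] V} (ha : ‖a‖ ≤ 1 / 2) : cayley a = (1 + a) * oneSubInv a := by
  have : (1 + a : V →L[ℂ] V) = 2 • 1 - (1 - a) := by rw [two_smul]; abel
  rw [this, sub_mul, mul_oneSubInv ha, cayley, smul_mul_assoc, one_mul]

theorem cayley_mul_cayley_neg {a : V →L[ℂ] V} (ha : ‖a‖ ≤ 1 / 2) :
    cayley a * cayley (-a) = 1 := by
  have ha' : ‖-a‖ ≤ 1 / 2 := by rwa [norm_neg]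
  have h := mul_oneSubInv ha'
  rw [sub_neg_eq_add] at h
  rw [cayley_eq ha, cayley_eq ha', ← sub_eq_add_neg, mul_assoc, ← mul_assoc (oneSubInv a),
    oneSubInv_mul ha, one_mul, h]

variable {A : Type*} [NonUnitalCStarAlgebra A] [PartialOrder A] [SMul A V] [CStarModule A V]

/-- The Cayley transform of a skew-adjoint operator is a unitary operator. -/
def cayleyIso {a : V →L[ℂ] V} (ha : ‖a‖ ≤ 1 / 2) (hskew : ∀ v w, ⟪a v, w⟫_A = -⟪v, a w⟫_A) :
    HilbertModuleIso A V V where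
  toContinuousLinearEquiv := ContinuousLinearEquiv.equivOfInverse (cayley a) (cayley (-a))
    (fun v => by
      have := cayley_mul_cayley_neg (a := -a) (by rwa [norm_neg])
      rw [neg_neg] at this
      exact congrArg (fun q : V →L[ℂ] V => q v) this)
    (fun v => congrArg (fun q : V →L[ℂ] V => q v) (cayley_mul_cayley_neg ha))
  inner_map v w := by
    change ⟪cayley a v, cayley a w⟫_A = _
    -- With `s = (1 - a)⁻¹ v` the vector is `s - a s` and its image is `s + a s`. The two inner
    -- products differ only in the cross terms, which cancel by skewness.
    have key : ∀ v, v = oneSubInv a v - a (oneSubInv a v) := fun v =>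
      (congrArg (fun q : V →L[ℂ] V => q v) (mul_oneSubInv ha)).symm
    have key' : ∀ v, cayley a v = oneSubInv a v + a (oneSubInv a v) := fun v => by
      rw [cayley_eq ha]; rfl
    rw [key' v, key' w]
    conv_rhs => rw [key v, key w]
    simp only [CStarModule.inner_add_left, CStarModule.inner_add_right,
      CStarModule.inner_sub_left, CStarModule.inner_sub_right]
    rw [hskew]
    abel

/-- For `s = (1 + U)⁻¹ v` one has `v = s + U s` and `cayleyInv U v = U s - s`; when the products are
expanded, the isometry property cancels all but the antisymmetric part. -/
theorem cayleyInv_skew (u : HilbertModuleIso A V V)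
    (hu : ‖(u.toContinuousLinearEquiv : V →L[ℂ] V) - 1‖ ≤ 1 / 4) (v w : V) :
    ⟪cayleyInv (u.toContinuousLinearEquiv : V →L[ℂ] V) v, w⟫_A
      = -⟪v, cayleyInv (u.toContinuousLinearEquiv : V →L[ℂ] V) w⟫_A := by
  set U := (u.toContinuousLinearEquiv : V →L[ℂ] V) with hU
  have hiso : ∀ v w, ⟪U v, U w⟫_A = ⟪v, w⟫_A := fun v w => u.inner_apply_apply v w
  set s : V → V := fun v => (2⁻¹ : ℝ) • oneSubInv ((2⁻¹ : ℝ) • (1 - U)) v with hs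
  have key : ∀ v, v = s v + U (s v) := fun v => by
    have h : v = oneSubInv ((2⁻¹ : ℝ) • (1 - U)) v - (2⁻¹ : ℝ) •
        (oneSubInv ((2⁻¹ : ℝ) • (1 - U)) v - U (oneSubInv ((2⁻¹ : ℝ) • (1 - U)) v)) :=
      (congrArg (fun q : V →L[ℂ] V => q v) (mul_oneSubInv (norm_half_smul_le hu))).symm
    rw [hs, ContinuousLinearMap.map_smul_of_tower]
    refine h.trans ?_
    module
  have key' : ∀ v, cayleyInv U v = U (s v) - s v := fun v => by
    have h1 : cayleyInv U v = v - (s v + s v) := by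
      simp only [cayleyInv, sub_apply, one_apply_eq_self, hs]
      module
    rw [h1]
    nth_rewrite 1 [key v]
    abel
  rw [key' v, key' w]
  conv_lhs => rw [key w]
  conv_rhs => rw [key v]
  simp only [CStarModule.inner_add_left, CStarModule.inner_add_right,
      CStarModule.inner_sub_left, CStarModule.inner_sub_right, hiso]
  abel

end Cayley

/-! ### Radial projection of a simplex onto its boundary -/

namespace AbstractSimplicialComplex

variable {ι : Type*} {X : AbstractSimplicialComplex ι}

/-- The sup-distance of two points of `|X|` in barycentric coordinates is at most `D`. -/
def CoordClose (D : ℝ) (x y : X.Realization) : Prop := ∀ v, |x.coord v - y.coord v| ≤ D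

theorem CoordClose.nonneg {D : ℝ} {x y : X.Realization} (h : CoordClose D x y) : 0 ≤ D :=
  (abs_nonneg _).trans (h (support_nonempty x).choose)

theorem CoordClose.trans {D D' : ℝ} {x y z : X.Realization} (h : CoordClose D x y)
    (h' : CoordClose D' y z) : CoordClose (D + D') x z := fun v =>
  (abs_sub_le _ (y.coord v) _).trans (add_le_add (h v) (h' v))

theorem CoordClose.symm {D : ℝ} {x y : X.Realization} (h : CoordClose D x y) :
    CoordClose D y x := fun v => by rw [abs_sub_comm]; exact h v

theorem coord_le_one (x : X.Realization) (v : ι) : x.coord v ≤ 1 := by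
  by_cases hv : v ∈ x.coord.support
  · rw [← x.sum_eq_one]
    exact Finset.single_le_sum (f := x.coord) (fun w _ => x.nonneg w) hv
  · rw [Finsupp.notMem_support_iff.1 hv]; exact zero_le_one

theorem coordClose_one (x y : X.Realization) : CoordClose 1 x y := fun v => by
  rw [abs_le]
  constructor <;> linarith [x.nonneg v, y.nonneg v, coord_le_one x v, coord_le_one y v]

theorem sum_coord {σ : Finset ι} {x : X.Realization} (hx : x ∈ X.closedSimplex σ) :
    ∑ v ∈ σ, x.coord v = 1 := by
  rw [← x.sum_eq_one, Finsupp.sum_of_support_subset _ hx _ (fun _ _ => rfl)]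

theorem exists_realization (σ : X.faces) (g : ι → ℝ) (hg : ∀ v ∈ σ.1, 0 ≤ g v)
    (hsum : ∑ v ∈ σ.1, g v = 1) :
    ∃ y ∈ X.closedSimplex σ.1, ∀ v ∈ σ.1, y.coord v = g v := by
  refine ⟨X.simplexMap σ ⟨fun v => g v, fun v => hg v v.2, ?_⟩, ?_, fun v hv => ?_⟩
  · rw [Finset.sum_coe_sort σ.1 g, hsum]
  · rw [← range_simplexMap]; exact ⟨_, rfl⟩
  · simp [simplexMap, hv]

theorem coord_eq_zero_of_mem {σ : Finset ι} {x : X.Realization} (hx : x ∈ X.closedSimplex σ)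
    {v : ι} (hv : v ∉ σ) : x.coord v = 0 :=
  Finsupp.notMem_support_iff.1 fun h => hv (hx h)

variable (X) in
/-- The boundary of a closed simplex. -/
def simplexBoundary (σ : Finset ι) : Set X.Realization :=
  {x | x ∈ X.closedSimplex σ ∧ ∃ v ∈ σ, x.coord v = 0}

/-- With `m` the least coordinate and `N` the number of vertices, `t = 1 - N m` and `r = (x - m) /
t`, so `t` vanishes at the barycentre only. The projection `r` is not Lipschitz there, but `t` times
its variation is controlled, which is all that the scaled extension `t · g(r)` needs. -/
theorem exists_radialProjection (σ : X.faces) (hσ : 2 ≤ σ.1.card) :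
    ∃ (t : X.Realization → ℝ) (r : X.Realization → X.Realization),
      (∀ x ∈ X.closedSimplex σ.1, 0 ≤ t x ∧ t x ≤ 1 ∧ r x ∈ X.simplexBoundary σ.1) ∧
      (∀ x ∈ X.simplexBoundary σ.1, t x = 1 ∧ r x = x) ∧
      ∀ x ∈ X.closedSimplex σ.1, ∀ y ∈ X.closedSimplex σ.1, ∀ D, CoordClose D x y →
        |t x - t y| ≤ σ.1.card * D ∧
        ∀ v, t x * |(r x).coord v - (r y).coord v| ≤ (σ.1.card + 2) * D := by
  classical
  have hne : σ.1.Nonempty := (X.isRelLowerSet_faces σ.2).1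
  set N : ℝ := (σ.1.card : ℝ) with hN
  have hN0 : 0 ≤ N := Nat.cast_nonneg _
  set m : X.Realization → ℝ := fun x => σ.1.inf' hne x.coord with hm
  set t : X.Realization → ℝ := fun x => 1 - N * m x with ht
  have m_le : ∀ x, ∀ v ∈ σ.1, m x ≤ x.coord v := fun x v hv => Finset.inf'_le _ hv
  have m_eq : ∀ x, ∃ v ∈ σ.1, m x = x.coord v := fun x => by
    obtain ⟨v, hv, h⟩ := Finset.exists_mem_eq_inf' hne x.coord
    exact ⟨v, hv, h⟩
  have m_nonneg : ∀ x, 0 ≤ m x := fun x => by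
    obtain ⟨v, -, h⟩ := m_eq x
    rw [h]; exact x.nonneg v
  have t_eq : ∀ x ∈ X.closedSimplex σ.1, t x = ∑ v ∈ σ.1, (x.coord v - m x) := fun x hx => by
    rw [Finset.sum_sub_distrib, sum_coord hx, Finset.sum_const, nsmul_eq_mul]
  have t_nonneg : ∀ x ∈ X.closedSimplex σ.1, 0 ≤ t x := fun x hx => by
    rw [t_eq x hx]; exact Finset.sum_nonneg fun v hv => sub_nonneg.2 (m_le x v hv)
  have m_lip : ∀ x y D, CoordClose D x y → m x - m y ≤ D := fun x y D h => by
    obtain ⟨v, hv, h'⟩ := m_eq y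
    linarith [m_le x v hv, (abs_le.1 (h v)).2]
  have hex : ∀ x ∈ X.closedSimplex σ.1, ∃ y ∈ X.simplexBoundary σ.1,
      ∀ v ∈ σ.1, t x * y.coord v = x.coord v - m x := by
    intro x hx
    rcases (t_nonneg x hx).eq_or_lt with h0 | hpos
    -- At the barycentre any boundary point serves; a vertex is one because there are at least two.
    · obtain ⟨a, ha, b, hb, hab⟩ := Finset.one_lt_card.1 hσ
      refine ⟨X.vertex a, ⟨X.vertex_mem_closedSimplex ha, b, hb, by simp [vertex, hab]⟩,
        fun v hv => ?_⟩
      rw [← h0, zero_mul]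
      have := t_eq x hx
      rw [← h0] at this
      exact ((Finset.sum_eq_zero_iff_of_nonneg
        fun w hw => sub_nonneg.2 (m_le x w hw)).1 this.symm v hv).symm
    · obtain ⟨y, hy, hyc⟩ := exists_realization σ (fun v => (x.coord v - m x) / t x)
        (fun v hv => div_nonneg (sub_nonneg.2 (m_le x v hv)) hpos.le)
        (by rw [← Finset.sum_div, ← t_eq x hx, div_self hpos.ne'])
      obtain ⟨w, hw, hmw⟩ := m_eq x
      refine ⟨y, ⟨hy, w, hw, ?_⟩, fun v hv => ?_⟩
      · rw [hyc w hw, hmw, sub_self, zero_div]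
      · rw [hyc v hv, mul_div_cancel₀ _ hpos.ne']
  choose! r hr hrc using hex
  refine ⟨t, r, fun x hx => ⟨t_nonneg x hx, ?_, hr x hx⟩, ?_, ?_⟩
  · exact sub_le_self _ (mul_nonneg hN0 (m_nonneg x))
  · rintro x ⟨hx, w, hw, hxw⟩
    have hm0 : m x = 0 := le_antisymm ((m_le x w hw).trans_eq hxw) (m_nonneg x)
    have ht1 : t x = 1 := by simp [ht, hm0]
    refine ⟨ht1, Realization.ext (Finsupp.ext fun v => ?_)⟩
    by_cases hv : v ∈ σ.1
    · have := hrc x hx v hv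
      rwa [ht1, one_mul, hm0, sub_zero] at this
    · rw [coord_eq_zero_of_mem hx hv, coord_eq_zero_of_mem (hr x hx).1 hv]
  · intro x hx y hy D h
    have h' : CoordClose D y x := fun v => by rw [abs_sub_comm]; exact h v
    have hmD : |m x - m y| ≤ D := abs_sub_le_iff.2 ⟨m_lip x y D h, m_lip y x D h'⟩
    have htD : |t x - t y| ≤ N * D := by
      rw [show t x - t y = -(N * (m x - m y)) by simp only [ht]; ring, abs_neg, abs_mul,
        abs_of_nonneg hN0]
      exact mul_le_mul_of_nonneg_left hmD hN0
    refine ⟨htD, fun v => ?_⟩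
    by_cases hv : v ∈ σ.1
    -- The three terms are at most `D`, `D` and `N D`, whence the constant `N + 2`.
    · have e : t x * ((r x).coord v - (r y).coord v) = (x.coord v - y.coord v) - (m x - m y)
          - (t x - t y) * (r y).coord v := by
        linear_combination hrc x hx v hv - hrc y hy v hv
      have e' : t x * |(r x).coord v - (r y).coord v|
          = |t x * ((r x).coord v - (r y).coord v)| := by
        rw [abs_mul, abs_of_nonneg (t_nonneg x hx)]
      rw [e', e]
      have h3 : |(t x - t y) * (r y).coord v| ≤ N * D := by
        rw [abs_mul, abs_of_nonneg ((r y).nonneg v)]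
        exact (mul_le_of_le_one_right (abs_nonneg _) (coord_le_one _ v)).trans htD
      refine (abs_sub _ _).trans ?_
      have h4 := abs_sub (x.coord v - y.coord v) (m x - m y)
      have h5 := h v
      linarith
    · rw [coord_eq_zero_of_mem (hr x hx).1 hv, coord_eq_zero_of_mem (hr y hy).1 hv]
      simp only [sub_self, abs_zero, mul_zero]
      exact mul_nonneg (by linarith) h.nonneg

end AbstractSimplicialComplex

/-! ### Unitary Lipschitz extension from the boundary of a simplex -/

open AbstractSimplicialComplex

/-- A unitary-valued Lipschitz function with small Lipschitz constant on the boundary of a simplex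
extends to the simplex. -/
theorem exists_unitary_extension {A V : Type*} [NonUnitalCStarAlgebra A] [PartialOrder A]
    [NormedAddCommGroup V] [NormedSpace ℂ V] [SMul A V] [CStarModule A V] [CompleteSpace V]
    {ι : Type*} {X : AbstractSimplicialComplex ι} (σ : X.faces) (hσ : 2 ≤ σ.1.card)
    (f : X.Realization → HilbertModuleIso A V V) {L : ℝ} (hL : L ≤ 1 / 4)
    (hf : ∀ x ∈ X.simplexBoundary σ.1, ∀ y ∈ X.simplexBoundary σ.1, ∀ D, CoordClose D x y →
      ‖((f x).toContinuousLinearEquiv : V →L[ℂ] V) - ((f y).toContinuousLinearEquiv : V →L[ℂ] V)‖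
        ≤ L * D) :
    ∃ F : X.Realization → HilbertModuleIso A V V,
      (∀ x ∈ X.simplexBoundary σ.1,
        (F x).toContinuousLinearEquiv = (f x).toContinuousLinearEquiv) ∧
      ∀ x ∈ X.closedSimplex σ.1, ∀ y ∈ X.closedSimplex σ.1, ∀ D, CoordClose D x y →
        ‖((F x).toContinuousLinearEquiv : V →L[ℂ] V) -
          ((F y).toContinuousLinearEquiv : V →L[ℂ] V)‖ ≤ 32 * (σ.1.card + 1) * L * D := by
  classical
  obtain ⟨t, r, h1, h2, h3⟩ := exists_radialProjection σ hσ
  obtain ⟨v₀, hv₀⟩ := (X.isRelLowerSet_faces σ.2).1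
  have hv₀' : X.vertex v₀ ∈ X.closedSimplex σ.1 := X.vertex_mem_closedSimplex hv₀
  set y₀ := r (X.vertex v₀)
  have hy₀ : y₀ ∈ X.simplexBoundary σ.1 := (h1 _ hv₀').2.2
  set N : ℝ := (σ.1.card : ℝ)
  have hN0 : 0 ≤ N := Nat.cast_nonneg _
  have hL0 : 0 ≤ L := by
    have := hf y₀ hy₀ y₀ hy₀ 1 (coordClose_one _ _)
    simpa using this
  set u : X.Realization → HilbertModuleIso A V V := fun x => (f x).trans (f y₀).symm
  set U : X.Realization → V →L[ℂ] V := fun x => ((u x).toContinuousLinearEquiv : V →L[ℂ] V)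
  have hU : ∀ x, U x = ((f y₀).toContinuousLinearEquiv.symm : V →L[ℂ] V) ∘L
    ((f x).toContinuousLinearEquiv : V →L[ℂ] V) := fun x => rfl
  have hU0 : U y₀ = 1 := by
    ext v
    simp [hU]
  have hUlip : ∀ x ∈ X.simplexBoundary σ.1, ∀ y ∈ X.simplexBoundary σ.1, ∀ D,
      CoordClose D x y → ‖U x - U y‖ ≤ L * D := fun x hx y hy D h => by
    rw [hU, hU, ← ContinuousLinearMap.comp_sub]
    exact (ContinuousLinearMap.opNorm_comp_le _ _).trans
      ((mul_le_of_le_one_left (norm_nonneg _) (f y₀).norm_symm_le_one).trans (hf x hx y hy D h))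
  -- The sup-diameter is at most 1, so a Lipschitz constant `L` also bounds the distance to the
  -- normalized value `U y₀ = 1`.
  have hU1 : ∀ x ∈ X.simplexBoundary σ.1, ‖U x - 1‖ ≤ L := fun x hx => by
    have := hUlip x hx y₀ hy₀ 1 (coordClose_one _ _)
    rwa [hU0, mul_one] at this
  set a : X.Realization → V →L[ℂ] V := fun x => t x • cayleyInv (U (r x))
  have hc : ∀ x ∈ X.closedSimplex σ.1, ‖cayleyInv (U (r x))‖ ≤ 2 * L := fun x hx =>
    (norm_cayleyInv_le ((hU1 _ (h1 x hx).2.2).trans hL)).trans (by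
      linarith [hU1 _ (h1 x hx).2.2])
  have ha : ∀ x ∈ X.closedSimplex σ.1, ‖a x‖ ≤ 1 / 2 := fun x hx => by
    rw [norm_smul, Real.norm_of_nonneg (h1 x hx).1]
    exact (mul_le_of_le_one_left (norm_nonneg _) (h1 x hx).2.1).trans
      ((hc x hx).trans (by linarith))
  have hskew : ∀ x ∈ X.closedSimplex σ.1, ∀ v w, ⟪a x v, w⟫_A = -⟪v, a x w⟫_A :=
    fun x hx v w => by
      simp only [a, smul_apply, CStarModule.inner_smul_left_real,
        CStarModule.inner_smul_right_real]
      rw [cayleyInv_skew (u (r x)) ((hU1 _ (h1 x hx).2.2).trans hL), smul_neg]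
  -- The variation of `t` gives `2N L D` and that of the boundary value `2(N + 2) L D`. The Cayley
  -- transform multiplies the sum by 8, which explains `32 (N + 1)`.
  have halip : ∀ x ∈ X.closedSimplex σ.1, ∀ y ∈ X.closedSimplex σ.1, ∀ D,
      CoordClose D x y → ‖a x - a y‖ ≤ 4 * (N + 1) * L * D := fun x hx y hy D h => by
    have hD := h.nonneg
    obtain ⟨ht, hr⟩ := h3 x hx y hy D h
    have e : a x - a y = (t x - t y) • cayleyInv (U (r y)) +
        t x • (cayleyInv (U (r x)) - cayleyInv (U (r y))) := by
      simp only [a]; module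
    have b1 : ‖(t x - t y) • cayleyInv (U (r y))‖ ≤ N * D * (2 * L) := by
      rw [norm_smul, Real.norm_eq_abs]
      exact mul_le_mul ht (hc y hy) (norm_nonneg _) (mul_nonneg hN0 hD)
    have b2 : ‖t x • (cayleyInv (U (r x)) - cayleyInv (U (r y)))‖ ≤ 2 * (L * ((N + 2) * D)) := by
      rw [norm_smul, Real.norm_of_nonneg (h1 x hx).1]
      rcases (h1 x hx).1.eq_or_lt with h0 | hpos
      · rw [← h0, zero_mul]; positivity
      -- The division by `t x` is undone by the scalar in front.
      · have hcl : CoordClose ((N + 2) * D / t x) (r x) (r y) := fun v => by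
          rw [le_div_iff₀ hpos, mul_comm]; exact hr v
        have b3 := hUlip _ (h1 x hx).2.2 _ (h1 y hy).2.2 _ hcl
        have b4 := norm_cayleyInv_sub_le ((hU1 _ (h1 x hx).2.2).trans hL)
          ((hU1 _ (h1 y hy).2.2).trans hL)
        calc _ ≤ t x * (2 * (L * ((N + 2) * D / t x))) := by
              refine mul_le_mul_of_nonneg_left (b4.trans ?_) hpos.le
              linarith
          _ = _ := by field_simp
    rw [e]
    refine (norm_add_le _ _).trans ((add_le_add b1 b2).trans_eq ?_)
    ring
  refine ⟨fun x => if hx : x ∈ X.closedSimplex σ.1 then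
    (cayleyIso (ha x hx) (hskew x hx)).trans (f y₀) else f y₀, fun x hx => ?_,
    fun x hx y hy D h => ?_⟩
  · ext v
    have hax : a x = cayleyInv (U x) := by
      simp only [a, (h2 x hx).1, (h2 x hx).2, one_smul]
    beta_reduce
    rw [dif_pos hx.1]
    change (f y₀).toContinuousLinearEquiv (cayley (a x) v) = _
    rw [hax, cayley_cayleyInv ((hU1 x hx).trans hL), hU]
    simp
  · beta_reduce
    rw [dif_pos hx, dif_pos hy]
    change ‖((f y₀).toContinuousLinearEquiv : V →L[ℂ] V) ∘L cayley (a x) -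
      ((f y₀).toContinuousLinearEquiv : V →L[ℂ] V) ∘L cayley (a y)‖ ≤ _
    rw [← ContinuousLinearMap.comp_sub]
    refine (ContinuousLinearMap.opNorm_comp_le _ _).trans
      ((mul_le_of_le_one_left (norm_nonneg _) (f y₀).norm_le_one).trans ?_)
    refine (norm_cayley_sub_le (ha x hx) (ha y hy)).trans ?_
    linarith [halip x hx y hy D h]

/-! ### Extension of trivializations over the skeleta -/

section Skeleta

variable {A V : Type*} [NonUnitalCStarAlgebra A] [PartialOrder A]
  [NormedAddCommGroup V] [NormedSpace ℂ V] [SMul A V] [CStarModule A V]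
  {ι : Type*} {X : AbstractSimplicialComplex ι} {E : X.Realization → Type*}
  [∀ b, NormedAddCommGroup (E b)] [∀ b, NormedSpace ℂ (E b)] [∀ b, SMul A (E b)]
  [∀ b, CStarModule A (E b)]

/-- The transition function `f⁻¹ g` of two families of isomorphisms `V → E_x`. -/
def familyTransition (f g : ∀ x, HilbertModuleIso A V (E x)) (x : X.Realization) : V →L[ℂ] V :=
  (((g x).trans (f x).symm).toContinuousLinearEquiv : V →L[ℂ] V)

/-- The transition function `f⁻¹ g` is `K`-Lipschitz on `S`, for the sup-distance in barycentric
coordinates. -/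
def LipschitzTransitionOn (K : ℝ) (f g : ∀ x, HilbertModuleIso A V (E x))
    (S : Set X.Realization) : Prop :=
  ∀ x ∈ S, ∀ y ∈ S, ∀ D, CoordClose D x y →
    ‖familyTransition f g x - familyTransition f g y‖ ≤ K * D

theorem LipschitzTransitionOn.mono_const {K K' : ℝ} {f g : ∀ x, HilbertModuleIso A V (E x)}
    {S : Set X.Realization} (h : LipschitzTransitionOn K f g S) (hK : K ≤ K') :
    LipschitzTransitionOn K' f g S := fun x hx y hy D hD =>
  (h x hx y hy D hD).trans (mul_le_mul_of_nonneg_right hK hD.nonneg)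

theorem norm_familyTransition_le (f g : ∀ x, HilbertModuleIso A V (E x)) (x : X.Realization) :
    ‖familyTransition f g x‖ ≤ 1 :=
  HilbertModuleIso.norm_le_one _

theorem familyTransition_comp (f g h : ∀ x, HilbertModuleIso A V (E x)) (x : X.Realization) :
    familyTransition f g x ∘L familyTransition g h x = familyTransition f h x := by
  ext v
  simp [familyTransition, HilbertModuleIso.trans, HilbertModuleIso.symm]

theorem familyTransition_self (f : ∀ x, HilbertModuleIso A V (E x)) (x : X.Realization) :
    familyTransition f f x = ContinuousLinearMap.id ℂ V := by
  ext v
  simp [familyTransition, HilbertModuleIso.trans, HilbertModuleIso.symm]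

theorem LipschitzTransitionOn.symm {K : ℝ} {f g : ∀ x, HilbertModuleIso A V (E x)}
    {S : Set X.Realization} (h : LipschitzTransitionOn K f g S) :
    LipschitzTransitionOn K g f S := fun x hx y hy D hD => by
  have e : familyTransition g f x - familyTransition g f y = familyTransition g f x ∘L
      (familyTransition f g y - familyTransition f g x) ∘L familyTransition g f y := by
    rw [ContinuousLinearMap.sub_comp, ContinuousLinearMap.comp_sub, familyTransition_comp,
      familyTransition_self, ← ContinuousLinearMap.comp_assoc, familyTransition_comp,
      familyTransition_self]
    rfl
  rw [e]
  refine (norm_comp_comp_le (norm_familyTransition_le _ _ _)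
    (norm_familyTransition_le _ _ _)).trans ?_
  rw [norm_sub_rev]
  exact h x hx y hy D hD

theorem LipschitzTransitionOn.trans {K K' : ℝ} {f g h : ∀ x, HilbertModuleIso A V (E x)}
    {S : Set X.Realization} (hfg : LipschitzTransitionOn K f g S)
    (hgh : LipschitzTransitionOn K' g h S) :
    LipschitzTransitionOn (K + K') f h S := fun x hx y hy D hD => by
  rw [← familyTransition_comp f g h, ← familyTransition_comp f g h, add_mul]
  exact (norm_comp_sub_comp_le (norm_familyTransition_le _ _ _)
    (norm_familyTransition_le _ _ _)).trans
      (add_le_add (hfg x hx y hy D hD) (hgh x hx y hy D hD))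

/-- The smallest simplex that contains a point. -/
def carrierFace (x : X.Realization) : X.faces := ⟨x.coord.support, x.support_mem⟩

theorem card_support_lt_of_mem_simplexBoundary {σ : Finset ι} {x : X.Realization}
    (hx : x ∈ X.simplexBoundary σ) : x.coord.support.card < σ.card := by
  obtain ⟨hx, v, hv, hxv⟩ := hx
  exact Finset.card_lt_card ⟨hx, fun h => (Finsupp.mem_support_iff.1 (h hv)) hxv⟩

theorem mem_simplexBoundary_or_eq {σ : X.faces} {x : X.Realization}
    (hx : x ∈ X.closedSimplex σ.1) : x ∈ X.simplexBoundary σ.1 ∨ carrierFace x = σ := by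
  by_cases h : σ.1 ⊆ x.coord.support
  · exact Or.inr (Subtype.ext (Finset.Subset.antisymm hx h))
  · obtain ⟨v, hv, hxv⟩ := Finset.not_subset.1 h
    exact Or.inl ⟨hx, v, hv, Finsupp.notMem_support_iff.1 hxv⟩

/-- The extensions over distinct `n`-vertex simplices do not interact: each changes `Ψ` only at
points whose carrier is that simplex, and it agrees with `Ψ` on the boundary. -/
theorem exists_extension_skeleton [CompleteSpace V]
    (Θ : X.faces → ∀ x, HilbertModuleIso A V (E x)) (Ψ : ∀ x, HilbertModuleIso A V (E x))
    {n : ℕ} (hn : 2 ≤ n) {L : ℝ} (hL : L ≤ 1 / 4)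
    (h : ∀ σ : X.faces, σ.1.card = n →
      LipschitzTransitionOn L (Θ σ) Ψ (X.simplexBoundary σ.1)) :
    ∃ Ψ' : ∀ x, HilbertModuleIso A V (E x),
      (∀ x : X.Realization, x.coord.support.card < n → Ψ' x = Ψ x) ∧
      ∀ σ : X.faces, σ.1.card = n →
        LipschitzTransitionOn (32 * (n + 1) * L) (Θ σ) Ψ' (X.closedSimplex σ.1) := by
  classical
  have hex : ∀ σ : X.faces, ∃ F : X.Realization → HilbertModuleIso A V V, σ.1.card = n →
      (∀ x ∈ X.simplexBoundary σ.1,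
        ((F x).toContinuousLinearEquiv : V →L[ℂ] V) = familyTransition (Θ σ) Ψ x) ∧
      ∀ x ∈ X.closedSimplex σ.1, ∀ y ∈ X.closedSimplex σ.1, ∀ D, CoordClose D x y →
        ‖((F x).toContinuousLinearEquiv : V →L[ℂ] V) -
          ((F y).toContinuousLinearEquiv : V →L[ℂ] V)‖ ≤ 32 * (n + 1) * L * D := by
    intro σ
    by_cases hσ : σ.1.card = n
    · obtain ⟨F, hF, hF'⟩ := exists_unitary_extension σ (hn.trans_eq hσ.symm)
        (fun x => (Ψ x).trans (Θ σ x).symm) hL (h σ hσ)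
      rw [hσ] at hF'
      refine ⟨F, fun _ => ⟨fun x hx => ?_, hF'⟩⟩
      rw [hF x hx]
      rfl
    · exact ⟨fun _ => .refl A V, fun h => absurd h hσ⟩
  choose F hF using hex
  let Ψ' : ∀ x, HilbertModuleIso A V (E x) := fun x =>
    if x.coord.support.card = n then (F (carrierFace x) x).trans (Θ (carrierFace x) x) else Ψ x
  have hΨ' : ∀ x : X.Realization, x.coord.support.card < n → Ψ' x = Ψ x := fun x hx =>
    if_neg hx.ne
  have key : ∀ σ : X.faces, σ.1.card = n → ∀ x ∈ X.closedSimplex σ.1,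
      familyTransition (Θ σ) Ψ' x = ((F σ x).toContinuousLinearEquiv : V →L[ℂ] V) := by
    intro σ hσ x hx
    rcases mem_simplexBoundary_or_eq hx with hb | rfl
    · rw [(hF σ hσ).1 x hb]
      have hlt := (card_support_lt_of_mem_simplexBoundary hb).trans_eq hσ
      rw [familyTransition, familyTransition, hΨ' x hlt]
    · have hc : x.coord.support.card = n := hσ
      rw [familyTransition, show Ψ' x = _ from if_pos hc]
      ext v
      simp [HilbertModuleIso.trans, HilbertModuleIso.symm]
  refine ⟨Ψ', hΨ', fun σ hσ x hx y hy D hD => ?_⟩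
  rw [key σ hσ x hx, key σ hσ y hy]
  exact (hF σ hσ).2 x hx y hy D hD

/-- Since `y` has zero `j`-coordinate, that of `x` is at most `D`. Moving this mass to a third
vertex `k` gives `z`. -/
theorem exists_mem_inter_facets {σ : X.faces} (hσ : 3 ≤ σ.1.card) {x y : X.Realization}
    (hx : x ∈ X.closedSimplex σ.1) {i j : ι} (hi : i ∈ σ.1) (hj : j ∈ σ.1)
    (hxi : x.coord i = 0) (hyj : y.coord j = 0) {D : ℝ} (h : CoordClose D x y) :
    ∃ z ∈ X.closedSimplex σ.1, z.coord i = 0 ∧ z.coord j = 0 ∧ CoordClose D x z := by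
  classical
  obtain ⟨k, hk, hkij⟩ : ∃ k ∈ σ.1, k ∉ ({i, j} : Finset ι) :=
    Finset.exists_mem_notMem_of_card_lt_card
      ((Finset.card_le_two).trans_lt (Nat.lt_of_succ_le hσ))
  simp only [Finset.mem_insert, Finset.mem_singleton, not_or] at hkij
  obtain ⟨hki, hkj⟩ := hkij
  have hxj : x.coord j ≤ D := by
    have := (abs_le.1 (h j)).2
    rwa [hyj, sub_zero] at this
  set g : ι → ℝ := fun v => x.coord v + (if v = k then x.coord j else 0) -
    (if v = j then x.coord j else 0) with hg
  obtain ⟨z, hz, hzc⟩ := exists_realization σ g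
    (fun v _ => by
      simp only [hg]
      have := x.nonneg v
      have := x.nonneg j
      split_ifs with h1 h2 h2
      · linarith
      · linarith
      · rw [h2]; linarith
      · linarith)
    (by simp [hg, Finset.sum_sub_distrib, Finset.sum_add_distrib, sum_coord hx, hj, hk])
  refine ⟨z, hz, ?_, ?_, fun v => ?_⟩
  · rw [hzc i hi]
    simp only [hg, hxi, Ne.symm hki, if_false]
    split_ifs with h1
    · rw [← h1, hxi]; norm_num
    · norm_num
  · rw [hzc j hj]
    simp [hg, Ne.symm hkj]
  · by_cases hv : v ∈ σ.1
    · rw [hzc v hv]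
      simp only [hg]
      have := x.nonneg j
      have := h.nonneg
      rw [abs_le]
      split_ifs <;> constructor <;> linarith
    · rw [coord_eq_zero_of_mem hx hv, coord_eq_zero_of_mem hz hv]
      simpa using h.nonneg

/-- Two boundary points are joined through a common point `z` of their facets, at distance at most
`D` from one and `2D` from the other; hence the factor 3. The facets of an edge do not meet, so
edges are treated by transport instead. -/
theorem lipschitzTransitionOn_simplexBoundary {f g : ∀ x, HilbertModuleIso A V (E x)} {K : ℝ}
    {σ : X.faces} (hσ : 3 ≤ σ.1.card)
    (h : ∀ ρ : X.faces, ρ.1 ⊂ σ.1 → LipschitzTransitionOn K f g (X.closedSimplex ρ.1)) :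
    LipschitzTransitionOn (3 * K) f g (X.simplexBoundary σ.1) := by
  classical
  have facet : ∀ i ∈ σ.1, ∀ x ∈ X.closedSimplex σ.1, ∀ y ∈ X.closedSimplex σ.1,
      x.coord i = 0 → y.coord i = 0 → ∀ D, CoordClose D x y →
      ‖familyTransition f g x - familyTransition f g y‖ ≤ K * D := by
    intro i hi x hx y hy hxi hyi
    have sub : ∀ x ∈ X.closedSimplex σ.1, x.coord i = 0 →
        x ∈ X.closedSimplex (σ.1.erase i) := fun x hx hxi v hv =>
      Finset.mem_erase.2 ⟨fun hvi => Finsupp.mem_support_iff.1 hv (hvi ▸ hxi), hx hv⟩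
    have hne : (σ.1.erase i).Nonempty := by
      rw [← Finset.card_pos, Finset.card_erase_of_mem hi]
      omega
    exact h ⟨σ.1.erase i, (X.isRelLowerSet_faces σ.2).2 (Finset.erase_subset _ _) hne⟩
      (Finset.erase_ssubset hi) x (sub x hx hxi) y (sub y hy hyi)
  rintro x ⟨hx, i, hi, hxi⟩ y ⟨hy, j, hj, hyj⟩ D hD
  obtain ⟨z, hz, hzi, hzj, hxz⟩ := exists_mem_inter_facets hσ hx hi hj hxi hyj hD
  have h1 := facet i hi x hx z hz hxi hzi D hxz
  have h2 := facet j hj z hz y hy hzj hyj (D + D) (hxz.symm.trans hD)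
  have h3 := norm_sub_le_norm_sub_add_norm_sub (familyTransition f g x) (familyTransition f g z)
    (familyTransition f g y)
  linarith

/-- The Lipschitz constants of the successive extensions over the skeleta. -/
def skeletonConst (N c : ℝ) : ℕ → ℝ
  | 0 => 96 * c
  -- Stage `k + 1` treats simplices with `k + 3` vertices: `96 (k + 4)` is the boundary factor 3
  -- times the extension factor `32 ((k + 3) + 1)`. The summand `N` comes from changing `Θ ρ` to `Θ
  -- σ`.
  | k + 1 => 96 * (k + 4) * (N + skeletonConst N c k)

theorem skeletonConst_nonneg {N c : ℝ} (hN : 0 ≤ N) (hc : 0 ≤ c) (k : ℕ) :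
    0 ≤ skeletonConst N c k := by
  induction k with
  | zero => simp only [skeletonConst]; positivity
  | succ k ih => simp only [skeletonConst]; positivity

theorem skeletonConst_mono {N c : ℝ} (hN : 0 ≤ N) (hc : 0 ≤ c) : Monotone (skeletonConst N c) := by
  refine monotone_nat_of_le_succ fun k => ?_
  have h := skeletonConst_nonneg hN hc k
  have hk : (0 : ℝ) ≤ k := Nat.cast_nonneg k
  simp only [skeletonConst]
  nlinarith [mul_nonneg hk hN, mul_nonneg hk h]

theorem exists_skeletonTrivialization [CompleteSpace V]
    (Θ : X.faces → ∀ x, HilbertModuleIso A V (E x)) (Ψ₀ : ∀ x, HilbertModuleIso A V (E x))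
    {N c ε : ℝ} (hN : 0 ≤ N) (hc : 0 ≤ c) (hε : 0 ≤ ε)
    (hΘ : ∀ ρ σ : X.faces, ρ.1 ⊆ σ.1 →
      LipschitzTransitionOn (N * ε) (Θ ρ) (Θ σ) (X.closedSimplex ρ.1))
    (hΨ₀ : ∀ σ : X.faces, σ.1.card = 2 →
      LipschitzTransitionOn (c * ε) (Θ σ) Ψ₀ (X.simplexBoundary σ.1))
    (m : ℕ) (hcε : c * ε ≤ 1 / 4) (hm : 3 * (N + skeletonConst N c m) * ε ≤ 1 / 4) :
    ∃ Ψ : ∀ x, HilbertModuleIso A V (E x), ∀ ρ : X.faces, ρ.1.card ≤ m + 2 →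
      LipschitzTransitionOn (skeletonConst N c m * ε) (Θ ρ) Ψ (X.closedSimplex ρ.1) := by
  induction m with
  | zero =>
    obtain ⟨Ψ, -, hΨ⟩ := exists_extension_skeleton Θ Ψ₀ le_rfl hcε hΨ₀
    refine ⟨Ψ, fun ρ hρ => ?_⟩
    -- A simplex with one vertex is a point, and nothing is to be shown there.
    rcases hρ.lt_or_eq with hlt | heq
    · intro x hx y hy D hD
      have hcard : ρ.1.card = 1 := le_antisymm (by omega)
        (Finset.card_pos.2 (X.isRelLowerSet_faces ρ.2).1)
      obtain ⟨v, hv⟩ := Finset.card_eq_one.1 hcard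
      have hxy : x = y := by
        have e : ∀ x ∈ X.closedSimplex ρ.1, x.coord v = 1 := fun x hx => by
          have := sum_coord hx
          rwa [hv, Finset.sum_singleton] at this
        refine Realization.ext (Finsupp.ext fun w => ?_)
        by_cases hw : w = v
        · rw [hw, e x hx, e y hy]
        · have hw' : w ∉ ρ.1 := by rw [hv]; simpa using hw
          rw [coord_eq_zero_of_mem hx hw', coord_eq_zero_of_mem hy hw']
      rw [hxy, sub_self, norm_zero]
      exact mul_nonneg (mul_nonneg (skeletonConst_nonneg hN hc _) hε) hD.nonneg
    · refine (hΨ ρ heq).mono_const (le_of_eq ?_)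
      simp only [skeletonConst]
      push_cast
      ring
  | succ m ih =>
    have hmono := skeletonConst_mono hN hc m.le_succ
    have hm' : 3 * (N + skeletonConst N c m) * ε ≤ 1 / 4 :=
      le_trans (by gcongr) hm
    obtain ⟨Ψ, hΨ⟩ := ih hm'
    have hb : ∀ σ : X.faces, σ.1.card = m + 3 →
        LipschitzTransitionOn (3 * (N * ε + skeletonConst N c m * ε)) (Θ σ) Ψ
          (X.simplexBoundary σ.1) := fun σ hσ =>
      lipschitzTransitionOn_simplexBoundary (by omega) fun ρ hρ =>
        (hΘ ρ σ hρ.1).symm.trans (hΨ ρ (by have := Finset.card_lt_card hρ; omega))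
    obtain ⟨Ψ', h1, h2⟩ := exists_extension_skeleton Θ Ψ (by omega) (by linarith) hb
    refine ⟨Ψ', fun ρ hρ => ?_⟩
    rcases hρ.lt_or_eq with hlt | heq
    · intro x hx y hy D hD
      have e : ∀ x ∈ X.closedSimplex ρ.1,
          familyTransition (Θ ρ) Ψ' x = familyTransition (Θ ρ) Ψ x := fun x hx => by
        rw [familyTransition, familyTransition, h1 x]
        have := Finset.card_le_card hx
        omega
      rw [e x hx, e y hy]
      exact ((hΨ ρ (by omega)).mono_const (mul_le_mul_of_nonneg_right hmono hε)) x hx y hy D hD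
    · refine (h2 ρ heq).mono_const (le_of_eq ?_)
      simp only [skeletonConst]
      push_cast
      ring

end Skeleta

/-! ### Connectedness and distances in the geometric realization -/

namespace AbstractSimplicialComplex

variable {ι : Type*} {X : AbstractSimplicialComplex ι}

-- The stars of the reachable vertices and those of the unreachable ones form two disjoint open sets
-- that cover `|X|`, because the vertices of a common simplex are adjacent.
variable (X) in
theorem reachable_of_preconnectedSpace [PreconnectedSpace X.Realization] (u v : ι) :
    X.edgeGraph.Reachable u v := by
  by_contra hv
  have hadj : ∀ (y : X.Realization) (a b : ι), y ∈ X.openStar a → y ∈ X.openStar b →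
      X.edgeGraph.Reachable u a → X.edgeGraph.Reachable u b := by
    intro y a b ha hb h
    by_cases hab : a = b
    · rwa [← hab]
    · exact h.trans (edgeGraph_adj_of_mem_face y.support_mem ha hb hab).reachable
  let S : Set X.Realization := ⋃ a ∈ {a | X.edgeGraph.Reachable u a}, X.openStar a
  let T : Set X.Realization := ⋃ a ∈ {a | ¬ X.edgeGraph.Reachable u a}, X.openStar a
  have hS : IsOpen S := isOpen_biUnion fun a _ => isOpen_openStar a
  have hT : IsOpen T := isOpen_biUnion fun a _ => isOpen_openStar a
  have hST : (Set.univ : Set X.Realization) ⊆ S ∪ T := fun y _ => by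
    obtain ⟨a, ha⟩ := support_nonempty y
    by_cases h : X.edgeGraph.Reachable u a
    · exact Or.inl (Set.mem_biUnion (show a ∈ {a | X.edgeGraph.Reachable u a} from h) ha)
    · exact Or.inr (Set.mem_biUnion (show a ∈ {a | ¬ X.edgeGraph.Reachable u a} from h) ha)
  obtain ⟨y, -, hyS, hyT⟩ := isPreconnected_univ S T hS hT hST
    ⟨X.vertex u, trivial, Set.mem_biUnion (show u ∈ {a | X.edgeGraph.Reachable u a} from
      .refl u) (vertex_mem_openStar u)⟩
    ⟨X.vertex v, trivial, Set.mem_biUnion (show v ∈ {a | ¬ X.edgeGraph.Reachable u a} from hv)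
      (vertex_mem_openStar v)⟩
  simp only [S, T, Set.mem_iUnion, Set.mem_ofPred_eq] at hyS hyT
  obtain ⟨a, ha, hya⟩ := hyS
  obtain ⟨b, hb, hyb⟩ := hyT
  exact hb (hadj y a b hya hyb ha)

theorem coordClose_simplexDist {σ : Finset ι} {x y : X.Realization}
    (hx : x ∈ X.closedSimplex σ) (hy : y ∈ X.closedSimplex σ) :
    CoordClose (X.simplexDist σ x y) x y := fun v => by
  by_cases hv : v ∈ σ
  · refine Real.abs_le_sqrt ?_
    exact Finset.single_le_sum (f := fun v => (x.coord v - y.coord v) ^ 2)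
      (fun w _ => sq_nonneg _) hv
  · rw [coord_eq_zero_of_mem hx hv, coord_eq_zero_of_mem hy hv, sub_self, abs_zero]
    exact Real.sqrt_nonneg _

theorem simplexDist_le {σ : Finset ι} {x y : X.Realization} {D : ℝ} (h : CoordClose D x y) :
    X.simplexDist σ x y ≤ σ.card * D := by
  have hD := h.nonneg
  refine Real.sqrt_le_iff.2 ⟨by positivity, ?_⟩
  have h1 : ∑ v ∈ σ, (x.coord v - y.coord v) ^ 2 ≤ ∑ _v ∈ σ, D ^ 2 :=
    Finset.sum_le_sum fun v _ => sq_le_sq' (abs_le.1 (h v)).1 (abs_le.1 (h v)).2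
  rw [Finset.sum_const, nsmul_eq_mul] at h1
  refine h1.trans ?_
  rw [mul_pow]
  refine mul_le_mul_of_nonneg_right ?_ (sq_nonneg D)
  have : σ.card ≤ σ.card ^ 2 := Nat.le_self_pow two_ne_zero _
  exact_mod_cast this

theorem continuous_simplexDist (σ : Finset ι) (y : X.Realization) :
    Continuous fun x : X.Realization => X.simplexDist σ x y := by
  refine Real.continuous_sqrt.comp (continuous_finsetSum _ fun v _ => ?_)
  exact ((continuous_coord v).sub continuous_const).pow 2

theorem isClosed_closedSimplex (σ : Finset ι) : IsClosed (X.closedSimplex σ) := by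
  have : X.closedSimplex σ = ⋂ v ∈ {v | v ∉ σ}, {x | x.coord v = 0} := by
    ext x
    simp only [closedSimplex, Set.mem_ofPred_eq, Set.mem_iInter]
    refine ⟨fun h v hv => coord_eq_zero_of_mem h hv, fun h v hv => ?_⟩
    by_contra hvσ
    exact (Finsupp.mem_support_iff.1 hv) (h v hvσ)
  rw [this]
  exact isClosed_biInter fun v _ => isClosed_eq (continuous_coord v) continuous_const

theorem vertex_injective : Function.Injective X.vertex := fun u v h => by
  have := congrArg (fun x : X.Realization => x.coord) h
  exact Finsupp.single_left_injective one_ne_zero this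

theorem eq_vertex_of_mem_simplexBoundary {u v : ι} (h : X.edgeGraph.Adj u v)
    {x : X.Realization} (hx : x ∈ X.simplexBoundary (X.edge h).1) :
    x = X.vertex u ∨ x = X.vertex v := by
  classical
  obtain ⟨hx, w, hw, hxw⟩ := hx
  have hd : (X.edge h).1 = {u, v} := by simp [edge]
  have hs := sum_coord hx
  rw [hd, Finset.sum_pair h.1] at hs
  have h0 : ∀ a, a ≠ u → a ≠ v → x.coord a = 0 := fun a hau hav =>
    coord_eq_zero_of_mem hx (by simp [hd, hau, hav])
  rw [hd, Finset.mem_insert, Finset.mem_singleton] at hw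
  have hne := h.1
  rcases hw with rfl | rfl
  · right
    refine Realization.ext (Finsupp.ext fun a => ?_)
    by_cases hav : a = v
    · subst hav; simp [vertex]; linarith
    · by_cases hau : a = w
      · subst hau; simp [vertex, Ne.symm hav, hxw]
      · simp [vertex, Ne.symm hav, h0 a hau hav]
  · left
    refine Realization.ext (Finsupp.ext fun a => ?_)
    by_cases hau : a = u
    · subst hau; simp [vertex]; linarith
    · by_cases hav : a = w
      · subst hav; simp [vertex, Ne.symm hau, hxw]
      · simp [vertex, Ne.symm hau, h0 a hau hav]

end AbstractSimplicialComplex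

/-! ### Global trivializations -/

section Global

variable {A V : Type*}
  [NonUnitalCStarAlgebra A] [PartialOrder A]
  [NormedAddCommGroup V] [NormedSpace ℂ V] [SMul A V] [CStarModule A V]
  {ι : Type*} {X : AbstractSimplicialComplex ι} {E : X.Realization → Type*}
  [∀ b, NormedAddCommGroup (E b)] [∀ b, NormedSpace ℂ (E b)] [∀ b, SMul A (E b)]
  [∀ b, CStarModule A (E b)]

theorem LipschitzTransitionOn.continuousOn {K : ℝ} {f g : ∀ x, HilbertModuleIso A V (E x)}
    {σ : Finset ι} (h : LipschitzTransitionOn K f g (X.closedSimplex σ)) :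
    ContinuousOn (familyTransition f g) (X.closedSimplex σ) := by
  intro x hx
  rw [ContinuousWithinAt, tendsto_iff_norm_sub_tendsto_zero]
  have hd : Filter.Tendsto (fun y => K * X.simplexDist σ y x) (𝓝[X.closedSimplex σ] x) (𝓝 0) := by
    have h0 : X.simplexDist σ x x = 0 := by simp [simplexDist]
    have := (continuous_const.mul (continuous_simplexDist σ x)).tendsto' (f := fun y =>
      K * X.simplexDist σ y x) x 0 (by rw [h0, mul_zero])
    exact this.mono_left nhdsWithin_le_nhds
  refine squeeze_zero' (Filter.Eventually.of_forall fun _ => norm_nonneg _) ?_ hd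
  filter_upwards [self_mem_nhdsWithin] with y hy
  exact h y hy x hx _ (coordClose_simplexDist hy hx)

variable [TopologicalSpace (TotalSpace V E)] [FiberBundle V E] [VectorBundle ℂ V E]

open Classical in
/-- The fibrewise isomorphisms of a trivialization over `|σ|`, extended arbitrarily to `|X|`. -/
def extendedIso (Φ : ∀ σ : X.faces, HilbertTrivializationOn A V E (X.closedSimplex σ.1))
    (σ : X.faces) (x : X.Realization) : HilbertModuleIso A V (E x) :=
  if h : x ∈ X.closedSimplex σ.1 then (Φ σ).iso ⟨x, h⟩
  else (Φ (carrierFace x)).iso ⟨x, Finset.Subset.refl _⟩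

variable {Φ : ∀ σ : X.faces, HilbertTrivializationOn A V E (X.closedSimplex σ.1)}

theorem extendedIso_of_mem {σ : X.faces} {x : X.Realization} (h : x ∈ X.closedSimplex σ.1) :
    extendedIso Φ σ x = (Φ σ).iso ⟨x, h⟩ :=
  dif_pos h

theorem IsFlatFamily.lipschitzTransitionOn [StarOrderedRing A] {ε : ℝ} (hε : 0 ≤ ε)
    (hΦ : IsFlatFamily ε Φ) {N : ℝ} (hN : ∀ σ : X.faces, (σ.1.card : ℝ) ≤ N) (ρ σ : X.faces)
    (h : ρ.1 ⊆ σ.1) :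
    LipschitzTransitionOn (N * ε) (extendedIso Φ ρ) (extendedIso Φ σ) (X.closedSimplex ρ.1) := by
  intro x hx y hy D hD
  have e : ∀ x (hx : x ∈ X.closedSimplex ρ.1),
      familyTransition (extendedIso Φ ρ) (extendedIso Φ σ) x =
      (Φ ρ).transition (Φ σ) (X.closedSimplex_mono h) ⟨x, hx⟩ := fun x hx => by
    rw [familyTransition, extendedIso_of_mem hx, extendedIso_of_mem (X.closedSimplex_mono h hx)]
    rfl
  rw [e x hx, e y hy]
  refine (hΦ ρ σ h ⟨x, hx⟩ ⟨y, hy⟩).trans ?_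
  rw [mul_comm N, mul_assoc]
  refine mul_le_mul_of_nonneg_left ((simplexDist_le hD).trans ?_) hε
  exact mul_le_mul_of_nonneg_right (hN ρ) hD.nonneg

theorem continuousOn_comp_of_lipschitzTransitionOn {K : ℝ}
    {Ψ : ∀ x, HilbertModuleIso A V (E x)} {σ : X.faces}
    (h : LipschitzTransitionOn K (extendedIso Φ σ) Ψ (X.closedSimplex σ.1))
    (e : Trivialization V (TotalSpace.proj : TotalSpace V E → X.Realization))
    [MemTrivializationAtlas e] :
    ContinuousOn (fun x => e.continuousLinearMapAt ℂ x ∘L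
      ((Ψ x).toContinuousLinearEquiv : V →L[ℂ] E x)) (e.baseSet ∩ X.closedSimplex σ.1) := by
  have h1 : ContinuousOn (fun x => e.continuousLinearMapAt ℂ x ∘L
      ((extendedIso Φ σ x).toContinuousLinearEquiv : V →L[ℂ] E x))
      (e.baseSet ∩ X.closedSimplex σ.1) := by
    rw [continuousOn_iff_continuous_domRestrict]
    have h2 := continuousOn_iff_continuous_domRestrict.1 ((Φ σ).continuousOn_iso e)
    have h3 : Continuous fun x : ↥(e.baseSet ∩ X.closedSimplex σ.1) =>
        (⟨⟨x.1, x.2.2⟩, x.2.1⟩ :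
          {x : X.closedSimplex σ.1 | (x : X.Realization) ∈ e.baseSet}) := by fun_prop
    refine (h2.comp h3).congr fun x => ?_
    simp only [Function.comp, Set.domRestrict_apply, extendedIso_of_mem x.2.2]
  refine (h1.clm_comp (h.continuousOn.mono Set.inter_subset_right)).congr fun x _ => ?_
  ext v
  simp [familyTransition, HilbertModuleIso.trans, HilbertModuleIso.symm]

/-- A family of isomorphisms with Lipschitz transition functions to the given trivializations over
the simplices of a finite simplicial complex is a trivialization. -/
def globalTrivialization (hX : X.faces.Finite) {K : ℝ} (Ψ : ∀ x, HilbertModuleIso A V (E x))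
    (h : ∀ σ : X.faces, LipschitzTransitionOn K (extendedIso Φ σ) Ψ (X.closedSimplex σ.1)) :
    HilbertTrivializationOn A V E (Set.univ : Set X.Realization) where
  iso x := Ψ x
  continuousOn_iso e _ := by
    have hfin : Finite X.faces := hX
    have hc : ContinuousOn (fun x => e.continuousLinearMapAt ℂ x ∘L
        ((Ψ x).toContinuousLinearEquiv : V →L[ℂ] E x)) e.baseSet := by
      intro x hx
      have hcover : (⋃ σ : X.faces, X.closedSimplex σ.1) = Set.univ :=
        Set.eq_univ_of_forall fun y => Set.mem_iUnion.2 ⟨carrierFace y, Finset.Subset.refl _⟩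
      refine ContinuousAt.continuousWithinAt ?_
      -- Neighbourhoods of `x` are the finite supremum of those within the closed simplices; a
      -- simplex that misses `x` contributes nothing, as it is closed.
      rw [ContinuousAt, ← nhdsWithin_univ, ← hcover, nhdsWithin_iUnion]
      refine Filter.tendsto_iSup.2 fun σ => ?_
      by_cases hxσ : x ∈ X.closedSimplex σ.1
      · have := continuousOn_comp_of_lipschitzTransitionOn (h σ) e x ⟨hx, hxσ⟩
        rwa [ContinuousWithinAt, Set.inter_comm, nhdsWithin_inter_of_mem'
          (mem_nhdsWithin_of_mem_nhds (e.open_baseSet.mem_nhds hx))] at this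
      · exact continuousWithinAt_of_notMem_closure
          (by rwa [(isClosed_closedSimplex σ.1).closure_eq])
    exact hc.comp continuous_subtype_val.continuousOn fun x hx => hx

theorem isGlobalTrivialization_globalTrivialization [StarOrderedRing A] (hX : X.faces.Finite)
    {K : ℝ}
    (Ψ : ∀ x, HilbertModuleIso A V (E x))
    (h : ∀ σ : X.faces, LipschitzTransitionOn K (extendedIso Φ σ) Ψ (X.closedSimplex σ.1)) :
    IsGlobalTrivialization K Φ (globalTrivialization hX Ψ h) := by
  intro ρ x y
  have e : ∀ x : X.closedSimplex ρ.1, familyTransition (extendedIso Φ ρ) Ψ x =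
      (Φ ρ).transition (globalTrivialization hX Ψ h) (Set.subset_univ _) x := fun x => by
    rw [familyTransition, extendedIso_of_mem x.2]
    rfl
  rw [← e, ← e]
  exact h ρ x x.2 y y.2 _ (coordClose_simplexDist x.2 y.2)

/-- A family of isomorphisms over the vertices extends to a family over `|X|`. -/
theorem exists_family_of_vertices
    (Φ : ∀ σ : X.faces, HilbertTrivializationOn A V E (X.closedSimplex σ.1))
    (ψ : ∀ v, HilbertModuleIso A V (E (X.vertex v))) :
    ∃ Ψ : ∀ x, HilbertModuleIso A V (E x), ∀ v, Ψ (X.vertex v) = ψ v := by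
  -- Away from the vertices any value will do. At a vertex the value is well defined because
  -- distinct labels give distinct points.
  have h : ∀ x : X.Realization, ∃ f : HilbertModuleIso A V (E x),
      ∀ v (hv : X.vertex v = x), hv ▸ ψ v = f := by
    intro x
    by_cases hx : ∃ v, X.vertex v = x
    · obtain ⟨v, rfl⟩ := hx
      refine ⟨ψ v, fun w hw => ?_⟩
      obtain rfl := vertex_injective hw
      rfl
    · exact ⟨extendedIso Φ (carrierFace x) x, fun v hv => absurd ⟨v, hv⟩ hx⟩
  choose Ψ hΨ using h
  exact ⟨Ψ, fun v => (hΨ _ v rfl).symm⟩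

/-- Transport of the trivialization at a base vertex along chosen paths is almost parallel along
the edges. -/
theorem IsFlatFamily.lipschitzTransitionOn_vertices [StarOrderedRing A] {ε c : ℝ} (hε : 0 ≤ ε)
    (hΦ : IsFlatFamily ε Φ) {x₀ : ι} (w : ∀ v, X.edgeGraph.Walk x₀ v) (hc : 0 ≤ c)
    (hw : ∀ {u v : ι} (h : X.edgeGraph.Adj u v), ∃ n : ℕ, 3 * √2 * n ≤ c ∧
      X.LoopMoves n ((w u).append (.cons h (w v).reverse)))
    {Ψ : ∀ x, HilbertModuleIso A V (E x)} (f₀ : HilbertModuleIso A V (E (X.vertex x₀)))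
    (hΨ : ∀ v, Ψ (X.vertex v) = f₀.trans (walkTransportIso Φ (w v))) {σ : X.faces}
    (hσ : σ.1.card = 2) :
    LipschitzTransitionOn (c * ε) (extendedIso Φ σ) Ψ (X.simplexBoundary σ.1) := by
  classical
  have main : ∀ {u v : ι} (h : X.edgeGraph.Adj u v), X.edge h = σ →
      ‖familyTransition (extendedIso Φ σ) Ψ (X.vertex u) -
        familyTransition (extendedIso Φ σ) Ψ (X.vertex v)‖ ≤ c * ε := by
    rintro u v h rfl
    obtain ⟨n, hn, hloop⟩ := hw h
    refine le_trans ?_ ((hΦ.norm_walkTransport_sub_id_le hloop).trans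
      (mul_le_mul_of_nonneg_right hn hε))
    -- With `τ` the transport around the loop, the difference is `Φ_e(v)⁻¹ T_{w(v)} (τ - 1) f₀`; the
    -- factor `f₀ f₀⁻¹` is inserted so that all outer factors are isometries between known modules.
    have e : familyTransition (extendedIso Φ (X.edge h)) Ψ (X.vertex u) -
        familyTransition (extendedIso Φ (X.edge h)) Ψ (X.vertex v) =
        ((((f₀.trans (walkTransportIso Φ (w v))).trans
          (extendedIso Φ (X.edge h) (X.vertex v)).symm).toContinuousLinearEquiv : V →L[ℂ] V)) ∘L
        (((f₀.symm).toContinuousLinearEquiv : E (X.vertex x₀) →L[ℂ] V) ∘L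
        ((walkTransport Φ ((w u).append (.cons h (w v).reverse)) :
          E (X.vertex x₀) →L[ℂ] E (X.vertex x₀)) - ContinuousLinearMap.id ℂ _) ∘L
        (f₀.toContinuousLinearEquiv : V →L[ℂ] E (X.vertex x₀))) := by
      ext y
      rw [familyTransition, familyTransition, hΨ, hΨ,
        extendedIso_of_mem (X.vertex_mem_closedSimplex (X.left_mem_edge h)),
        extendedIso_of_mem (X.vertex_mem_closedSimplex (X.right_mem_edge h))]
      simp [HilbertModuleIso.trans, HilbertModuleIso.symm, walkTransport_append, walkTransport,
        walkTransport_reverse, toContinuousLinearEquiv_walkTransportIso, edgeTransport]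
    rw [e]
    refine (ContinuousLinearMap.opNorm_comp_le _ _).trans
      ((mul_le_of_le_one_left (norm_nonneg _) (HilbertModuleIso.norm_le_one _)).trans ?_)
    exact norm_comp_comp_le (HilbertModuleIso.norm_le_one _) (HilbertModuleIso.norm_le_one _)
  obtain ⟨u, v, huv, hσuv⟩ := Finset.card_eq_two.1 hσ
  have hadj : X.edgeGraph.Adj u v :=
    edgeGraph_adj_of_mem_face σ.2 (by simp [hσuv]) (by simp [hσuv]) huv
  have hedge : X.edge hadj = σ := Subtype.ext (by simp [edge, hσuv])
  -- Distinct vertices have sup-distance 1, so the bound for the two endpoints is already a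
  -- Lipschitz bound.
  have hone : ∀ {D : ℝ} {a b : ι}, a ≠ b → CoordClose D (X.vertex a) (X.vertex b) → 1 ≤ D := by
    intro D a b hab hD
    have := hD a
    simpa [vertex, hab.symm, hab] using this
  intro x hx y hy D hD
  have hcε := mul_nonneg hc hε
  rw [← hedge] at hx hy
  rcases eq_vertex_of_mem_simplexBoundary hadj hx with rfl | rfl <;>
    rcases eq_vertex_of_mem_simplexBoundary hadj hy with rfl | rfl
  · rw [sub_self, norm_zero]; exact mul_nonneg hcε hD.nonneg
  · exact (main hadj hedge).trans (le_mul_of_one_le_right hcε (hone huv hD))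
  · rw [norm_sub_rev]
    exact (main hadj hedge).trans (le_mul_of_one_le_right hcε (hone huv.symm hD))
  · rw [sub_self, norm_zero]; exact mul_nonneg hcε hD.nonneg

end Global

theorem IsHilbertModuleBundle.completeSpace {A V : Type*} {B : Type*} {E : B → Type*}
    [NonUnitalCStarAlgebra A] [PartialOrder A] [StarOrderedRing A]
    [NormedAddCommGroup V] [NormedSpace ℂ V] [SMul A V] [CStarModule A V]
    [∀ b, NormedAddCommGroup (E b)] [∀ b, NormedSpace ℂ (E b)] [∀ b, SMul A (E b)]
    [∀ b, CStarModule A (E b)]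
    [TopologicalSpace B] [TopologicalSpace (TotalSpace V E)]
    [FiberBundle V E] [VectorBundle ℂ V E] (h : IsHilbertModuleBundle A V E) : CompleteSpace V :=
  h.fiber_finitelyGeneratedProjective.completeSpace

end

/-! ### The main theorem -/

theorem mainTheorem2 :
    (∃ c δ : ℕ → ℝ, (∀ n, 0 < c n) ∧ (∀ n, 0 < δ n) ∧
      ∀ (ι : Type*) (X : AbstractSimplicialComplex ι) (x : ι) (Γ : X.edgeGraph.Walk x x),
        X.IsContractibleLoop Γ →
        ∃ n : ℕ, X.homotopicalComplexity Γ = n ∧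
          ∀ (A : Type*) [NonUnitalCStarAlgebra A] [PartialOrder A] [StarOrderedRing A]
            (V : Type*) [NormedAddCommGroup V] [NormedSpace ℂ V] [SMul A V] [CStarModule A V]
            (E : X.Realization → Type*)
            [∀ b, NormedAddCommGroup (E b)] [∀ b, NormedSpace ℂ (E b)] [∀ b, SMul A (E b)]
            [∀ b, CStarModule A (E b)]
            [TopologicalSpace (Bundle.TotalSpace V E)] [FiberBundle V E] [VectorBundle ℂ V E]
            [IsHilbertModuleBundle A V E]
            (Φ : ∀ σ : X.faces, HilbertTrivializationOn A V E (X.closedSimplex σ.1))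
            (ε : ℝ), 0 < ε → ε ≤ δ n → IsFlatFamily ε Φ →
            ‖(walkTransport Φ Γ : E (X.vertex x) →L[ℂ] E (X.vertex x))
              - ContinuousLinearMap.id ℂ (E (X.vertex x))‖ ≤ c n * ε) ∧
    (∀ (ι : Type*) (X : AbstractSimplicialComplex ι),
      X.faces.Finite → ContractibleSpace X.Realization →
      ∃ C δ : ℝ, 0 < C ∧ 0 < δ ∧
        ∀ (A : Type*) [NonUnitalCStarAlgebra A] [PartialOrder A] [StarOrderedRing A]
          (V : Type*) [NormedAddCommGroup V] [NormedSpace ℂ V] [SMul A V] [CStarModule A V]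
          (E : X.Realization → Type*)
          [∀ b, NormedAddCommGroup (E b)] [∀ b, NormedSpace ℂ (E b)] [∀ b, SMul A (E b)]
          [∀ b, CStarModule A (E b)]
          [TopologicalSpace (Bundle.TotalSpace V E)] [FiberBundle V E] [VectorBundle ℂ V E]
          [IsHilbertModuleBundle A V E]
          (Φ : ∀ σ : X.faces, HilbertTrivializationOn A V E (X.closedSimplex σ.1))
          (ε : ℝ), 0 < ε → ε ≤ δ → IsFlatFamily ε Φ →
          ∃ ΦX : HilbertTrivializationOn A V E (Set.univ : Set X.Realization),
            IsGlobalTrivialization (C * ε) Φ ΦX) := by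
  -- The summand 1 keeps `c 0` positive; `δ` is arbitrary.
  refine ⟨⟨fun n => 3 * √2 * n + 1, fun _ => 1, fun n => by positivity, fun _ => one_pos, ?_⟩, ?_⟩
  · intro ι X x Γ hΓ
    obtain ⟨n, hn, hmoves⟩ := AbstractSimplicialComplex.exists_loopMoves_eq_homotopicalComplexity hΓ
    refine ⟨n, hn, ?_⟩
    intro A _ _ _ V _ _ _ _ E _ _ _ _ _ _ _ _ Φ ε hε _ hΦ
    refine (hΦ.norm_walkTransport_sub_id_le hmoves).trans ?_
    exact mul_le_mul_of_nonneg_right (by linarith) hε.le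
  · intro ι X hX hcontr
    have hfin : Finite X.faces := hX
    obtain ⟨y₀⟩ : Nonempty X.Realization := inferInstance
    obtain ⟨x₀, -⟩ := AbstractSimplicialComplex.support_nonempty y₀
    have hι : Finite ι := Finite.of_injective
      (fun v => (⟨{v}, X.singleton_mem v⟩ : X.faces)) fun u v h => by simpa using h
    have w : ∀ v, X.edgeGraph.Walk x₀ v := fun v => (X.reachable_of_preconnectedSpace x₀ v).some
    -- A contractible space is simply connected, so every loop has finite complexity by the covering
    -- argument.
    have hloop : ∀ (u v : ι) (h : X.edgeGraph.Adj u v), ∃ n,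
        X.LoopMoves n ((w u).append (.cons h (w v).reverse)) := fun u v h =>
      AbstractSimplicialComplex.exists_loopMoves_of_isContractibleLoop
        (SimplyConnectedSpace.paths_homotopic _ _)
    choose n hn using hloop
    obtain ⟨n₀, hn₀⟩ := Finite.exists_le
      (fun p : {p : ι × ι // X.edgeGraph.Adj p.1 p.2} => n p.1.1 p.1.2 p.2)
    obtain ⟨N, hN⟩ := Finite.exists_le (fun σ : X.faces => σ.1.card)
    have hN' : ∀ σ : X.faces, (σ.1.card : ℝ) ≤ (N : ℝ) := fun σ => Nat.cast_le.2 (hN σ)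
    set c : ℝ := 3 * √2 * n₀ with hc
    have hc0 : 0 ≤ c := by positivity
    have hN0 : (0 : ℝ) ≤ N := Nat.cast_nonneg _
    have hk : 0 ≤ skeletonConst N c N := skeletonConst_nonneg hN0 hc0 N
    -- Chosen so that `M ε ≤ 1` yields both smallness conditions of the induction, `c ε ≤ 1/4` and
    -- `3 (N + skeletonConst N c N) ε ≤ 1/4`.
    set M : ℝ := 4 * c + 12 * (N + skeletonConst N c N) + 1 with hM
    have hM0 : 0 < M := by positivity
    refine ⟨skeletonConst N c N + 1, 1 / M, by positivity, by positivity, ?_⟩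
    intro A _ _ _ V _ _ _ _ E _ _ _ _ _ _ _ hE Φ ε hε hεδ hΦ
    have := hE.completeSpace
    have hεM : M * ε ≤ 1 := by
      rwa [le_div_iff₀ hM0, mul_comm] at hεδ
    obtain ⟨Ψ₀, hΨ₀⟩ := exists_family_of_vertices Φ fun v =>
      ((Φ ⟨{x₀}, X.singleton_mem x₀⟩).iso ⟨X.vertex x₀, X.vertex_mem_closedSimplex
        (Finset.mem_singleton_self x₀)⟩).trans (walkTransportIso Φ (w v))
    have hb : ∀ σ : X.faces, σ.1.card = 2 →
        LipschitzTransitionOn (c * ε) (extendedIso Φ σ) Ψ₀ (X.simplexBoundary σ.1) := fun σ hσ =>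
      hΦ.lipschitzTransitionOn_vertices hε.le w hc0 (fun {u v} h => ⟨n u v h, by
        rw [hc]
        gcongr
        exact_mod_cast hn₀ ⟨(u, v), h⟩, hn u v h⟩) _ hΨ₀ hσ
    have p1 : 0 ≤ c * ε := mul_nonneg hc0 hε.le
    have p2 : 0 ≤ (N + skeletonConst N c N) * ε := mul_nonneg (add_nonneg hN0 hk) hε.le
    have hsplit : M * ε = 4 * (c * ε) + 12 * ((N + skeletonConst N c N) * ε) + ε := by
      rw [hM]; ring
    -- Taking `m = N` stages reaches every simplex, since none has more than `N` vertices.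
    obtain ⟨Ψ, hΨ⟩ := exists_skeletonTrivialization (extendedIso Φ) Ψ₀ hN0 hc0 hε.le
      (hΦ.lipschitzTransitionOn hε.le hN') hb N (by linarith) (by linarith)
    have hΨ' : ∀ σ : X.faces, LipschitzTransitionOn ((skeletonConst N c N + 1) * ε)
        (extendedIso Φ σ) Ψ (X.closedSimplex σ.1) := fun σ =>
      (hΨ σ ((hN σ).trans (by omega))).mono_const
        (mul_le_mul_of_nonneg_right (by linarith) hε.le)
    exact ⟨_, isGlobalTrivialization_globalTrivialization hX Ψ hΨ'⟩
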